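/- Let $F:\mathbb{R}^d\to\mathbb{R}$, $L_0,L_1,\sigma\ge 0$ and $F^*\in\mathbb{R}$ satisfy the following. (i) Lower boundedness: $F(x)\ge F^*$ for all $x\in\mathbb{R}^d$. (ii) $(L_0,L_1)$-smoothness: $F$ is continuously differentiable and, for all $x,y\in\mathbb{R}^d$ with $L_1\|x-y\|\le 1$, $$\|\nabla F(x)-\nabla F(y)\|\le\Big(L_0+L_1\max_{u\in[x,y]}\|\nabla F(u)\|\Big)\|x-y\|,$$ where $[x,y]$ is the line segment between $x$ and $y$. (In particular this holds if $F$ is differentiable and $\|\nabla F(x)-\nabla F(y)\|\le(L_0+L_1\|\nabla F(x)\|)\|x-y\|$ whenever $L_1\|x-y\|\le 1$, or if $F$ is twice continuously differentiable with $\|\nabla^2F(x)\|\le L_0+L_1\|\nabla F(x)\|$ for all $x$.) (iii) Bounded variance: the stochastic gradient oracle $\nabla f(x,\xi)$, jointly measurable in $(x,\xi)$, satisfies, for every $x\in\mathbb{R}^d$ and $\xi\sim\mathcal{D}$, $\mathbb{E}[\nabla f(x,\xi)]=\nabla F(x)$ and $\mathbb{E}\|\nabla f(x,\xi)-\nabla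 F(x)\|^2\le\sigma^2$. Let $\beta_t:=1-t^{-1/2}$ and $\eta_t:=t^{-3/4}/7$ for $t\ge 1$. Let $\xi_1,\xi_2,\dots$ be i.i.d. with law $\mathcal{D}$, and let $(x_t)_{t\ge1}$ be the iterates of normalized SGD with momentum (NSGD-M) started at a deterministic $x_1\in\mathbb{R}^d$: $m_0=0$ and, for $t\ge1$, $$m_t=\beta_t m_{t-1}+(1-\beta_t)\nabla f(x_t,\xi_t),\qquad x_{t+1}=x_t-\eta_t\frac{m_t}{\|m_t\|},$$ where $x_{t+1}=x_t$ if $m_t=0$. Put $\Delta_1:=F(x_1)-F^*$. Then all the expectations $\mathbb{E}\|\nabla F(x_t)\|$, $t\ge1$, are finite, and for every integer $T\ge1$ $$\frac1T\sum_{t=1}^T\mathbb{E}\|\nabla F(x_t)\|\le\frac{\big(14+96L_1e^{L_1^2}\big)\Delta_1+\big(14e^{L_1/7}+9\log T+2e^{L_1^2}\big)L_0+12e\,\sigma\log T+6e^{L_1^2}\min\big\{\tfrac{L_0}{L_1},\sqrt{8L_0\Delta_1}\big\}}{T^{1/4}},$$ where $L_0/L_1$ is read as $+\infty$ if $L_1=0$.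 Furthermore, if $L_1\ge 7/2$, then for every integer $T\ge1$ $$\frac1T\sum_{t=1}^T\mathbb{E}\|\nabla F(x_t)\|\le\frac{126e^{L_1^2}\Delta_1+12e\,\sigma\log T+\big(4e^{L_1^2}+9\log T\big)L_0}{T^{1/4}}.$$ -/

import Mathlib

open MeasureTheory ProbabilityTheory

noncomputable section

/-- `(L₀, L₁)`-smoothness of `F : ℝᵈ → ℝ`: `F` is continuously differentiable and
`‖∇F x - ∇F y‖ ≤ (L₀ + L₁ max_{u ∈ [x, y]} ‖∇F u‖) ‖x - y‖` whenever `‖x - y‖ ≤ 1 / L₁`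
(no restriction if `L₁ = 0`). The gradient is continuous, so the maximum over the segment is
attained and the inequality says that it holds with `‖∇F u‖` for some `u ∈ [x, y]`. -/
structure IsL0L1Smooth {d : ℕ} (L₀ L₁ : ℝ) (F : EuclideanSpace ℝ (Fin d) → ℝ) : Prop where
  contDiff : ContDiff ℝ 1 F
  norm_gradient_sub_le : ∀ x y : EuclideanSpace ℝ (Fin d), L₁ * ‖x - y‖ ≤ 1 →
    ∃ u ∈ segment ℝ x y,
      ‖gradient F x - gradient F y‖ ≤ (L₀ + L₁ * ‖gradient F u‖) * ‖x - y‖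

/-- The variant of the definition with `‖∇F x‖` in place of the maximum over the segment, for a
merely differentiable `F`, is a special case. -/
theorem IsL0L1Smooth.of_pointwise {d : ℕ} {L₀ L₁ : ℝ} {F : EuclideanSpace ℝ (Fin d) → ℝ}
    (hF : Differentiable ℝ F)
    (h : ∀ x y : EuclideanSpace ℝ (Fin d), L₁ * ‖x - y‖ ≤ 1 →
      ‖gradient F x - gradient F y‖ ≤ (L₀ + L₁ * ‖gradient F x‖) * ‖x - y‖) :
    IsL0L1Smooth L₀ L₁ F := by
  refine ⟨?_, fun x y hxy => ⟨x, left_mem_segment ℝ x y, h x y hxy⟩⟩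
  have hc : Continuous (gradient F) := by
    rw [continuous_iff_continuousAt]
    intro x
    have h1 : Filter.Tendsto (fun y => ‖x - y‖) (nhds x) (nhds 0) := by
      have : Continuous (fun y => ‖x - y‖) := by fun_prop
      simpa using this.tendsto x
    have h2 : ∀ᶠ y in nhds x, L₁ * ‖x - y‖ ≤ 1 := by
      have h3 : Filter.Tendsto (fun y => L₁ * ‖x - y‖) (nhds x) (nhds 0) := by
        simpa using h1.const_mul L₁
      exact h3.eventually_le_const one_pos
    refine tendsto_iff_norm_sub_tendsto_zero.2 (squeeze_zero' (Filter.Eventually.of_forall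
      fun y => norm_nonneg _) (h2.mono fun y hy => ?_)
      (by simpa using h1.const_mul (L₀ + L₁ * ‖gradient F x‖)))
    rw [norm_sub_rev]
    exact h x y hy
  rw [contDiff_one_iff_fderiv]
  refine ⟨hF, ?_⟩
  have : fderiv ℝ F = fun x => InnerProductSpace.toDual ℝ _ (gradient F x) := by
    funext x
    simp [gradient]
  rw [this]
  exact (InnerProductSpace.toDual ℝ (EuclideanSpace ℝ (Fin d))).continuous.comp hc

/-- `g x z` (the stochastic gradient `∇f(x, z)` at `x` for the sample `z ∼ D`) is an unbiased
estimator of `∇F x` whose variance is at most `σ²`, at every point `x`. -/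
structure IsBoundedVarianceOracle {d : ℕ} {Ξ : Type*} [MeasurableSpace Ξ]
    (F : EuclideanSpace ℝ (Fin d) → ℝ) (D : Measure Ξ) (σ : ℝ)
    (g : EuclideanSpace ℝ (Fin d) → Ξ → EuclideanSpace ℝ (Fin d)) : Prop where
  measurable : Measurable (Function.uncurry g)
  integrable : ∀ x, Integrable (g x) D
  unbiased : ∀ x, ∫ z, g x z ∂D = gradient F x
  integrable_sq : ∀ x, Integrable (fun z => ‖g x z - gradient F x‖ ^ 2) D
  variance_le : ∀ x, ∫ z, ‖g x z - gradient F x‖ ^ 2 ∂D ≤ σ ^ 2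

/-- Normalized SGD with momentum, with stepsizes `η t` and momentum parameters `β t`, `t ≥ 1`.
`nsgdmState β η g x₁ s k` is the pair `(x_{k+1}, m_k)`, where `m_0 = 0` and, for `t ≥ 1`,
`m_t = β_t m_{t-1} + (1 - β_t) g_t`, `x_{t+1} = x_t - η_t m_t / ‖m_t‖` with `g_t = g x_t ξ_t`.
The sample `ξ_t` is `s (t - 1)`. If `m_t = 0`, the iterate does not move. -/
def nsgdmState {d : ℕ} {Ξ : Type*} (β η : ℕ → ℝ)
    (g : EuclideanSpace ℝ (Fin d) → Ξ → EuclideanSpace ℝ (Fin d))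
    (x₁ : EuclideanSpace ℝ (Fin d)) (s : ℕ → Ξ) :
    ℕ → EuclideanSpace ℝ (Fin d) × EuclideanSpace ℝ (Fin d)
  | 0 => (x₁, 0)
  | k + 1 =>
    let x := (nsgdmState β η g x₁ s k).1
    let m := β (k + 1) • (nsgdmState β η g x₁ s k).2 + (1 - β (k + 1)) • g x (s k)
    (x - (η (k + 1) / ‖m‖) • m, m)

/-- The iterate `x_t`, `t ≥ 1`, of normalized SGD with momentum. -/
def nsgdmIterate {d : ℕ} {Ξ : Type*} (β η : ℕ → ℝ)
    (g : EuclideanSpace ℝ (Fin d) → Ξ → EuclideanSpace ℝ (Fin d))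
    (x₁ : EuclideanSpace ℝ (Fin d)) (s : ℕ → Ξ) (t : ℕ) : EuclideanSpace ℝ (Fin d) :=
  (nsgdmState β η g x₁ s (t - 1)).1

/-- The momentum parameters `β_t = 1 - t^{-1/2}`. -/
def agnosticMomentum (t : ℕ) : ℝ := 1 - (t : ℝ) ^ (-(1 / 2) : ℝ)

/-- The stepsizes `η_t = t^{-3/4} / 7`. -/
def agnosticStepsize (t : ℕ) : ℝ := (t : ℝ) ^ (-(3 / 4) : ℝ) / 7

/-- `min {L₀ / L₁, √(8 L₀ Δ)}`, where `L₀ / L₁` is read as `+∞` if `L₁ = 0`. -/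
def minRatioSqrt (L₀ L₁ Δ : ℝ) : ℝ :=
  if L₁ = 0 then √(8 * L₀ * Δ) else min (L₀ / L₁) √(8 * L₀ * Δ)

end

/-! Write w = t^(-1/4), so that η_t = w³/7, 1 - β_t = w² and 1/t = w⁴. Normalization has two
effects. A step decreases F by η‖∇F‖, up to 2η times the momentum error and a second-order term; and
the distance travelled is at most Σ η, whatever the noise does. Grönwall's inequality along segments
turns the local smoothness condition into estimates at any distance, with a factor exp(L₁‖v‖)
(`norm_gradient_add_sub_le`, `apply_add_le`).

By linearity the momentum error is the averaged noise N plus a drift. The drift contracts by 1 - w²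
at each step and is absorbed by a potential (`energy_le`). Fresh samples are centred and independent
of the past, so E‖N‖² ≤ σ²w², and the noise costs a multiple of σ Σ w⁴, which is logarithmic.

The stepsizes do not know L₁, so the remainder of order L₁w⁴‖∇F‖ is dominated by the progress w³‖∇F‖
only once L₁w ≤ 1. Before that time, t < L₁⁴, the iterates have travelled a distance O(L₁) and
Grönwall compares their gradients with the one at x₁: this is the origin of exp(L₁²)
(`gradient_remainder_le`). The gradient at x₁ is in turn controlled by Δ₁ (`norm_gradient_le`).
Dividing by the smallest weight gives the average. -/

/-- The Grönwall bound is at most `(δ + ε) exp K` at time one. -/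
theorem gronwallBound_one_le {δ K ε : ℝ} (hK : 0 ≤ K) (hε : 0 ≤ ε) :
    gronwallBound δ K ε 1 ≤ (δ + ε) * Real.exp K := by
  rcases hK.eq_or_lt with rfl | hK
  · simp [gronwallBound_K0]
  · rw [gronwallBound_of_K_ne_0 hK.ne']
    have h1 : Real.exp K - 1 ≤ K * Real.exp K := by
      have h2 : 1 - K ≤ Real.exp (-K) := by linarith [Real.add_one_le_exp (-K)]
      have h3 := mul_le_mul_of_nonneg_right h2 (Real.exp_pos K).le
      rw [← Real.exp_add] at h3
      simp at h3
      linarith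
    have h4 : ε / K * (Real.exp K - 1) ≤ ε / K * (K * Real.exp K) := by gcongr
    have h5 : ε / K * (K * Real.exp K) = ε * Real.exp K := by field_simp
    simp only [mul_one]
    linarith

/-! ### Consequences of `(L₀, L₁)`-smoothness: gradient growth, descent, gradient versus gap. -/

namespace IsL0L1Smooth

variable {d : ℕ} {L₀ L₁ : ℝ} {F : EuclideanSpace ℝ (Fin d) → ℝ}

theorem continuous_gradient (hF : IsL0L1Smooth L₀ L₁ F) : Continuous (gradient F) := by
  have h : gradient F = fun x => (InnerProductSpace.toDual ℝ _).symm (fderiv ℝ F x) := rfl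
  rw [h]
  exact (LinearIsometryEquiv.continuous _).comp (hF.contDiff.continuous_fderiv one_ne_zero)

theorem hasGradientAt (hF : IsL0L1Smooth L₀ L₁ F) (x : EuclideanSpace ℝ (Fin d)) :
    HasGradientAt F (gradient F x) x :=
  (hF.contDiff.differentiable one_ne_zero x).hasGradientAt

/-- Along a line, the upper right derivative of `‖∇F - c‖` is controlled by the local smoothness. -/
theorem frequently_slope_lt (hF : IsL0L1Smooth L₀ L₁ F) (x v c : EuclideanSpace ℝ (Fin d))
    (s r : ℝ) (hr : (L₀ + L₁ * ‖gradient F (x + s • v)‖) * ‖v‖ < r) :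
    ∃ᶠ z in nhdsWithin s (Set.Ioi s),
      (z - s)⁻¹ * (‖gradient F (x + z • v) - c‖ - ‖gradient F (x + s • v) - c‖) < r := by
  have hc := hF.continuous_gradient
  have hp : Continuous fun z : ℝ => x + z • v := by fun_prop
  have h1 : ∀ᶠ u in nhds (x + s • v), (L₀ + L₁ * ‖gradient F u‖) * ‖v‖ < r := by
    have : Continuous fun u => (L₀ + L₁ * ‖gradient F u‖) * ‖v‖ := by fun_prop
    exact (this.tendsto _).eventually_lt_const hr
  obtain ⟨ε, hε, hball⟩ := Metric.eventually_nhds_iff_ball.1 h1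
  have h2 : ∀ᶠ z in nhds s, x + z • v ∈ Metric.ball (x + s • v) ε :=
    (hp.tendsto s).eventually (Metric.ball_mem_nhds _ hε)
  have h3 : ∀ᶠ z in nhds s, L₁ * ‖(x + z • v) - (x + s • v)‖ ≤ 1 := by
    have h4 : Continuous fun z : ℝ => L₁ * ‖(x + z • v) - (x + s • v)‖ := by fun_prop
    have h5 := h4.tendsto s
    simp only [sub_self, norm_zero, mul_zero] at h5
    exact h5.eventually_le_const one_pos
  refine Filter.Eventually.frequently ?_
  filter_upwards [nhdsWithin_le_nhds h2, nhdsWithin_le_nhds h3, self_mem_nhdsWithin]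
    with z hz2 hz3 hz
  have hz : 0 < z - s := sub_pos.2 hz
  -- The point `u` is not under control, but balls are convex, so it lies where the local constant
  -- is already below `r`.
  obtain ⟨u, hu, hle⟩ := hF.norm_gradient_sub_le _ _ hz3
  have hu' := hball u ((convex_ball _ _).segment_subset hz2 (Metric.mem_ball_self hε) hu)
  have hn : ‖(x + z • v) - (x + s • v)‖ = (z - s) * ‖v‖ := by
    rw [add_sub_add_left_eq_sub, ← sub_smul, norm_smul, Real.norm_of_nonneg hz.le]
  rw [hn] at hle
  have h6 : ‖gradient F (x + z • v) - c‖ - ‖gradient F (x + s • v) - c‖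
      ≤ ‖gradient F (x + z • v) - gradient F (x + s • v)‖ := by
    refine (norm_sub_norm_le _ _).trans (le_of_eq ?_)
    congr 1
    abel
  calc (z - s)⁻¹ * (‖gradient F (x + z • v) - c‖ - ‖gradient F (x + s • v) - c‖)
      ≤ (z - s)⁻¹ * ((L₀ + L₁ * ‖gradient F u‖) * ((z - s) * ‖v‖)) := by
        gcongr
        exact h6.trans hle
    _ = (L₀ + L₁ * ‖gradient F u‖) * ‖v‖ := by field_simp
    _ < r := hu'

/-- Grönwall on `[0, 1]` along the segment. Smoothness enters only infinitesimally, so `v` may be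
longer than `1 / L₁`. -/
theorem norm_gradient_add_sub_le (hF : IsL0L1Smooth L₀ L₁ F) (hL₀ : 0 ≤ L₀) (hL₁ : 0 ≤ L₁)
    (x v : EuclideanSpace ℝ (Fin d)) :
    ‖gradient F (x + v) - gradient F x‖
      ≤ (L₀ + L₁ * ‖gradient F x‖) * ‖v‖ * Real.exp (L₁ * ‖v‖) := by
  have hc := hF.continuous_gradient
  have h := le_gronwallBound_of_liminf_deriv_right_le
    (f := fun s : ℝ => ‖gradient F (x + s • v) - gradient F x‖)
    (f' := fun s : ℝ => (L₀ + L₁ * ‖gradient F (x + s • v)‖) * ‖v‖)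
    (δ := 0) (K := L₁ * ‖v‖) (ε := (L₀ + L₁ * ‖gradient F x‖) * ‖v‖) (a := 0) (b := 1)
    (by fun_prop) (fun s _ r hr => hF.frequently_slope_lt x v _ s r hr) (by simp)
    (fun s _ => by
      have h1 : ‖gradient F (x + s • v)‖
          ≤ ‖gradient F (x + s • v) - gradient F x‖ + ‖gradient F x‖ := by
        simpa using norm_add_le (gradient F (x + s • v) - gradient F x) (gradient F x)
      have h2 := mul_le_mul_of_nonneg_left h1 (mul_nonneg hL₁ (norm_nonneg v))
      nlinarith) 1 (by simp)
  rw [sub_zero] at h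
  simpa using h.trans (gronwallBound_one_le (by positivity) (by positivity))

theorem norm_gradient_add_le (hF : IsL0L1Smooth L₀ L₁ F) (hL₀ : 0 ≤ L₀) (hL₁ : 0 ≤ L₁)
    (x v : EuclideanSpace ℝ (Fin d)) :
    ‖gradient F (x + v)‖ ≤ (‖gradient F x‖ + L₀ * ‖v‖) * Real.exp (L₁ * ‖v‖) := by
  have hc := hF.continuous_gradient
  have h := le_gronwallBound_of_liminf_deriv_right_le
    (f := fun s : ℝ => ‖gradient F (x + s • v)‖)
    (f' := fun s : ℝ => (L₀ + L₁ * ‖gradient F (x + s • v)‖) * ‖v‖)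
    (δ := ‖gradient F x‖) (K := L₁ * ‖v‖) (ε := L₀ * ‖v‖) (a := 0) (b := 1)
    (by fun_prop) (fun s _ r hr => by simpa using hF.frequently_slope_lt x v 0 s r hr) (by simp)
    (fun s _ => by linarith) 1 (by simp)
  rw [sub_zero] at h
  simpa using h.trans (gronwallBound_one_le (by positivity) (by positivity))

/-- The descent inequality for `(L₀, L₁)`-smooth functions. -/
theorem apply_add_le (hF : IsL0L1Smooth L₀ L₁ F) (hL₀ : 0 ≤ L₀) (hL₁ : 0 ≤ L₁)
    (x v : EuclideanSpace ℝ (Fin d)) :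
    F (x + v) ≤ F x + inner ℝ (gradient F x) v
      + (L₀ + L₁ * ‖gradient F x‖) * ‖v‖ ^ 2 * Real.exp (L₁ * ‖v‖) / 2 := by
  set C := (L₀ + L₁ * ‖gradient F x‖) * ‖v‖ ^ 2 * Real.exp (L₁ * ‖v‖) with hC
  have hd (s : ℝ) : HasDerivAt (fun s : ℝ => F (x + s • v))
      (inner ℝ (gradient F (x + s • v)) v) s := by
    have h1 : HasDerivAt (fun s : ℝ => x + s • v) v s := by
      simpa using ((hasDerivAt_id s).smul_const v).const_add x
    have h2 := (hF.hasGradientAt (x + s • v)).hasFDerivAt.comp_hasDerivAt s h1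
    simpa [Function.comp_def] using h2
  -- With the exponential frozen at its value for `s = 1`, the majorant is a quadratic in `s` whose
  -- derivative dominates that of `F` along the segment.
  have hB (s : ℝ) : HasDerivAt
      (fun s : ℝ => F x + s * inner ℝ (gradient F x) v + C * s ^ 2 / 2)
      (inner ℝ (gradient F x) v + C * s) s := by
    have h1 := (((hasDerivAt_id s).mul_const (inner ℝ (gradient F x) v)).const_add (F x)).add
      ((((hasDerivAt_id s).pow 2).const_mul C).div_const 2)
    convert! h1 using 1
    simp
    ring
  have h := image_le_of_deriv_right_le_deriv_boundary (a := 0) (b := 1)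
    (f := fun s : ℝ => F (x + s • v)) (fun s _ => (hd s).continuousAt.continuousWithinAt)
    (fun s _ => (hd s).hasDerivWithinAt) (by simp)
    (fun s _ => (hB s).continuousAt.continuousWithinAt) (fun s _ => (hB s).hasDerivWithinAt)
    (fun s hs => ?_) (x := 1) (by simp)
  · simpa using h
  · have h1 := hF.norm_gradient_add_sub_le hL₀ hL₁ x (s • v)
    rw [norm_smul, Real.norm_of_nonneg hs.1] at h1
    have h2 := real_inner_le_norm (gradient F (x + s • v) - gradient F x) v
    rw [inner_sub_left] at h2
    have h3 : L₁ * (s * ‖v‖) ≤ L₁ * ‖v‖ := by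
      gcongr
      exact mul_le_of_le_one_left (norm_nonneg _) hs.2.le
    have h4 : ‖gradient F (x + s • v) - gradient F x‖ * ‖v‖ ≤ C * s := by
      calc _ ≤ (L₀ + L₁ * ‖gradient F x‖) * (s * ‖v‖) * Real.exp (L₁ * ‖v‖) * ‖v‖ := by
            refine mul_le_mul_of_nonneg_right (h1.trans ?_) (norm_nonneg _)
            have := hs.1
            gcongr
        _ = C * s := by rw [hC]; ring
    linarith

/-- A gradient step from `x` cannot go below `Fstar`; the step length `1 / (2 (L₀ + L₁ ‖∇F x‖))`
keeps the exponential factor below 2. -/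
theorem norm_gradient_sq_le (hF : IsL0L1Smooth L₀ L₁ F) (hL₀ : 0 ≤ L₀) (hL₁ : 0 ≤ L₁)
    {Fstar : ℝ} (hlower : ∀ x, Fstar ≤ F x) (x : EuclideanSpace ℝ (Fin d)) :
    ‖gradient F x‖ ^ 2 ≤ 4 * (F x - Fstar) * (L₀ + L₁ * ‖gradient F x‖) := by
  set G := ‖gradient F x‖ with hG
  have hG0 : 0 ≤ G := norm_nonneg _
  have hA : 0 ≤ L₀ + L₁ * G := by positivity
  have key (r : ℝ) (hr : 0 ≤ r) :
      r * G ^ 2 ≤ F x - Fstar + (L₀ + L₁ * G) * (r * G) ^ 2 * Real.exp (L₁ * (r * G)) / 2 := by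
    have h := hF.apply_add_le hL₀ hL₁ x ((-r) • gradient F x)
    rw [inner_smul_right, real_inner_self_eq_norm_sq, norm_smul, norm_neg,
      Real.norm_of_nonneg hr, ← hG] at h
    linarith [hlower (x + (-r) • gradient F x)]
  rcases hA.eq_or_lt with h0 | h0
  -- The quadratic term vanishes here, so a long enough step would decrease `F` by `F x - Fstar +
  -- 1`.
  · by_contra! hcon
    rw [← h0] at hcon key
    have hG2 : 0 < G ^ 2 := by simpa using hcon
    have h1 := key ((F x - Fstar + 1) / G ^ 2)
      (div_nonneg (by linarith [hlower x]) hG2.le)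
    rw [div_mul_cancel₀ _ hG2.ne'] at h1
    linarith
  · have h1 := key (1 / (2 * (L₀ + L₁ * G))) (by positivity)
    have h2 : L₁ * (1 / (2 * (L₀ + L₁ * G)) * G) ≤ 1 / 2 := by
      have : L₁ * (1 / (2 * (L₀ + L₁ * G)) * G) = (L₁ * G) / (2 * (L₀ + L₁ * G)) := by
        field_simp
      rw [this, div_le_div_iff₀ (by positivity) (by norm_num)]
      linarith
    have h3 : Real.exp (L₁ * (1 / (2 * (L₀ + L₁ * G)) * G)) ≤ 2 := by
      refine (Real.exp_le_exp.2 h2).trans ?_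
      have := Real.exp_bound_div_one_sub_of_interval (x := 1 / 2) (by norm_num) (by norm_num)
      norm_num at this ⊢
      linarith
    have h4 : (L₀ + L₁ * G) * (1 / (2 * (L₀ + L₁ * G)) * G) ^ 2 = G ^ 2 / (4 * (L₀ + L₁ * G)) := by
      field_simp
      norm_num
    rw [h4] at h1
    have h5 : G ^ 2 / (4 * (L₀ + L₁ * G)) * Real.exp (L₁ * (1 / (2 * (L₀ + L₁ * G)) * G)) / 2
      ≤ G ^ 2 / (4 * (L₀ + L₁ * G)) * 2 / 2 := by gcongr
    have h6 : 1 / (2 * (L₀ + L₁ * G)) * G ^ 2 = 2 * (G ^ 2 / (4 * (L₀ + L₁ * G))) := by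
      field_simp
      ring
    have h7 : G ^ 2 / (4 * (L₀ + L₁ * G)) ≤ F x - Fstar := by linarith
    rw [div_le_iff₀ (by positivity)] at h7
    linarith

/-- The larger of `L₀` and `L₁ ‖∇F x‖` decides which summand suffices: if `L₁ ‖∇F x‖` dominates, the
squared bound becomes linear; otherwise both entries of the minimum bound the gradient. -/
theorem norm_gradient_le (hF : IsL0L1Smooth L₀ L₁ F) (hL₀ : 0 ≤ L₀) (hL₁ : 0 ≤ L₁)
    {Fstar : ℝ} (hlower : ∀ x, Fstar ≤ F x) (x : EuclideanSpace ℝ (Fin d)) :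
    ‖gradient F x‖ ≤ 8 * L₁ * (F x - Fstar) + minRatioSqrt L₀ L₁ (F x - Fstar) := by
  have h := hF.norm_gradient_sq_le hL₀ hL₁ hlower x
  have hΔ : 0 ≤ F x - Fstar := sub_nonneg.2 (hlower x)
  generalize F x - Fstar = Δ at *
  generalize hG' : ‖gradient F x‖ = G at *
  have hG : 0 ≤ G := hG' ▸ norm_nonneg _
  have hm : 0 ≤ minRatioSqrt L₀ L₁ Δ := by
    unfold minRatioSqrt
    split_ifs <;> positivity
  by_cases hc : L₀ < L₁ * G
  · have h1 : G * G ≤ (8 * L₁ * Δ) * G := by nlinarith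
    have hGpos : 0 < G := by
      rcases hG.eq_or_lt with h0 | h0
      · rw [← h0] at hc; linarith
      · exact h0
    linarith [le_of_mul_le_mul_right h1 hGpos]
  · push Not at hc
    have h1 : G ≤ √(8 * L₀ * Δ) := by
      apply Real.le_sqrt_of_sq_le
      nlinarith
    have h2 : G ≤ minRatioSqrt L₀ L₁ Δ := by
      unfold minRatioSqrt
      split_ifs with h0
      · exact h1
      · have : 0 < L₁ := lt_of_le_of_ne hL₁ (Ne.symm h0)
        refine le_min ?_ h1
        rw [le_div_iff₀ this]
        linarith
    have : 0 ≤ 8 * L₁ * Δ := by positivity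
    linarith

end IsL0L1Smooth

/-! ### Powers of the weight `t^{-1/4}` and their sums. -/

noncomputable section

/-- The weight `t^{-1/4}` at `t = k + 1`; stepsizes and momentum parameters are polynomials in it. -/
def decayWeight (k : ℕ) : ℝ := ((k : ℝ) + 1) ^ (-(1 / 4) : ℝ)

theorem decayWeight_pos (k : ℕ) : 0 < decayWeight k := Real.rpow_pos_of_pos (by positivity) _

theorem decayWeight_pow (k n : ℕ) : decayWeight k ^ n = ((k : ℝ) + 1) ^ (-(n / 4) : ℝ) := by
  unfold decayWeight
  rw [← Real.rpow_natCast, ← Real.rpow_mul (by positivity)]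
  congr 1
  ring

theorem decayWeight_pow_four (k : ℕ) : decayWeight k ^ 4 = ((k : ℝ) + 1)⁻¹ := by
  rw [decayWeight_pow]
  norm_num [Real.rpow_neg_one]

theorem decayWeight_zero : decayWeight 0 = 1 := by simp [decayWeight]

theorem decayWeight_antitone : Antitone decayWeight := fun a b h =>
  Real.rpow_le_rpow_of_nonpos (by positivity) (by gcongr) (by norm_num)

theorem decayWeight_le_one (k : ℕ) : decayWeight k ≤ 1 :=
  decayWeight_zero ▸ decayWeight_antitone (Nat.zero_le k)

theorem one_sub_decayWeight_sq_nonneg (k : ℕ) : 0 ≤ 1 - decayWeight k ^ 2 :=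
  sub_nonneg.2 (pow_le_one₀ (decayWeight_pos k).le (decayWeight_le_one k))

theorem agnosticMomentum_succ (k : ℕ) : agnosticMomentum (k + 1) = 1 - decayWeight k ^ 2 := by
  rw [decayWeight_pow, agnosticMomentum]
  push_cast
  norm_num

theorem agnosticStepsize_succ (k : ℕ) : agnosticStepsize (k + 1) = decayWeight k ^ 3 / 7 := by
  rw [decayWeight_pow, agnosticStepsize]
  push_cast
  rfl

/-- With `a`, `b` the successive inverse weights, `a⁴ = b⁴ + 1` reduces the telescoping and variance
estimates to polynomial inequalities. -/
theorem inv_decayWeight_succ_pow_four (k : ℕ) :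
    (decayWeight (k + 1))⁻¹ ^ 4 = (decayWeight k)⁻¹ ^ 4 + 1 := by
  rw [inv_pow, inv_pow, decayWeight_pow_four, decayWeight_pow_four]
  simp

theorem inv_decayWeight_le_succ (k : ℕ) : (decayWeight k)⁻¹ ≤ (decayWeight (k + 1))⁻¹ :=
  inv_anti₀ (decayWeight_pos _) (decayWeight_antitone (Nat.le_succ k))

theorem one_le_inv_decayWeight (k : ℕ) : 1 ≤ (decayWeight k)⁻¹ :=
  (one_le_inv₀ (decayWeight_pos k)).2 (decayWeight_le_one k)

/-- Telescoping: factoring `a⁴ - b⁴ = 1` with `b ≤ a` gives `a⁻³ ≤ 4 (a - b)`. -/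
theorem sum_decayWeight_pow_three_le (n : ℕ) :
    ∑ k ∈ Finset.range (n + 1), decayWeight k ^ 3 ≤ 4 * (decayWeight n)⁻¹ := by
  induction n with
  | zero => simp [decayWeight_zero]
  | succ n ih =>
    rw [Finset.sum_range_succ]
    have h4 := inv_decayWeight_succ_pow_four n
    have hle := inv_decayWeight_le_succ n
    have hb := one_le_inv_decayWeight n
    rw [← inv_inv (decayWeight (n + 1)), inv_inv (decayWeight (n + 1))⁻¹]
    generalize (decayWeight (n + 1))⁻¹ = a at *
    generalize (decayWeight n)⁻¹ = b at *
    have ha0 : 0 < a := by linarith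
    have h : 1 ≤ (a - b) * (4 * a ^ 3) := by
      have e : (a - b) * (a ^ 3 + a ^ 2 * b + a * b ^ 2 + b ^ 3) = 1 := by linear_combination h4
      rw [← e]
      have h0 : 0 ≤ a - b := by linarith
      have h1 : a ^ 2 * b ≤ a ^ 2 * a := by gcongr
      have h2 : a * b ^ 2 ≤ a * a ^ 2 := by gcongr
      have h3 : b ^ 3 ≤ a ^ 3 := by gcongr
      gcongr
      nlinarith
    have : a⁻¹ ^ 3 ≤ 4 * (a - b) := by
      rw [inv_pow, inv_le_iff_one_le_mul₀ (by positivity)]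
      linarith
    linarith

theorem sum_decayWeight_pow_six_le (n : ℕ) :
    ∑ k ∈ Finset.range n, decayWeight k ^ 6 ≤ 3 := by
  -- The extra term `- 2 w²` makes the induction telescope, with equality at `n = 0`.
  have key (n : ℕ) : ∑ k ∈ Finset.range (n + 1), decayWeight k ^ 6 ≤ 3 - 2 * decayWeight n ^ 2 := by
    induction n with
    | zero => norm_num [decayWeight_zero]
    | succ n ih =>
      rw [Finset.sum_range_succ]
      have h4 := inv_decayWeight_succ_pow_four n
      have hle := inv_decayWeight_le_succ n
      have hb := one_le_inv_decayWeight n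
      have hw : decayWeight (n + 1) = (decayWeight (n + 1))⁻¹⁻¹ := (inv_inv _).symm
      have hw' : decayWeight n = (decayWeight n)⁻¹⁻¹ := (inv_inv _).symm
      rw [hw'] at ih
      rw [hw]
      generalize (decayWeight (n + 1))⁻¹ = a at *
      generalize (decayWeight n)⁻¹ = b at *
      have hb0 : 0 < b := by linarith
      have ha0 : 0 < a := by linarith
      have h : a⁻¹ ^ 6 ≤ 2 * b⁻¹ ^ 2 - 2 * a⁻¹ ^ 2 := by
        have e : 2 * b⁻¹ ^ 2 - 2 * a⁻¹ ^ 2 = 2 / (a ^ 2 * b ^ 2 * (a ^ 2 + b ^ 2)) := by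
          field_simp
          linear_combination h4
        rw [e, inv_pow, inv_eq_one_div, div_le_div_iff₀ (by positivity) (by positivity)]
        have h1 : b ^ 2 ≤ a ^ 2 := by gcongr
        calc 1 * (a ^ 2 * b ^ 2 * (a ^ 2 + b ^ 2)) ≤ 1 * (a ^ 2 * a ^ 2 * (a ^ 2 + a ^ 2)) := by
              gcongr
          _ = 2 * a ^ 6 := by ring
      linarith
  cases n with
  | zero => simp
  | succ n => linarith [key n, sq_nonneg (decayWeight n)]

theorem sum_decayWeight_pow_four_le (n : ℕ) :
    ∑ k ∈ Finset.range n, decayWeight k ^ 4 ≤ 1 + Real.log n := by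
  have h := harmonic_le_one_add_log n
  simp only [harmonic, Rat.cast_sum, Rat.cast_inv, Rat.cast_natCast] at h
  simp only [decayWeight_pow_four]
  exact_mod_cast h

/-- The weights decrease, so the condition selects an initial stretch of times; at its last index
the inverse weight is below `L`. -/
theorem sum_ite_decayWeight_pow_three_le {L : ℝ} (hL : 0 ≤ L) (n : ℕ) :
    ∑ k ∈ Finset.range n, (if 1 < L * decayWeight k then decayWeight k ^ 3 else 0) ≤ 4 * L := by
  induction n with
  | zero => simpa using hL
  | succ n ih =>
    by_cases h : 1 < L * decayWeight n
    · calc _ ≤ ∑ k ∈ Finset.range (n + 1), decayWeight k ^ 3 := by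
            refine Finset.sum_le_sum fun k _ => ?_
            have := decayWeight_pos k
            split_ifs
            · exact le_rfl
            · positivity
        _ ≤ 4 * (decayWeight n)⁻¹ := sum_decayWeight_pow_three_le n
        _ ≤ 4 * L := by
            gcongr
            rw [inv_le_iff_one_le_mul₀ (decayWeight_pos n)]
            exact h.le
    · rw [Finset.sum_range_succ, if_neg h, add_zero]
      exact ih

/-- Induction step for the bound `σ² w²` on the second moment of the noise. It reduces to `a² - 1 ≤
b²`, which follows from `(a² - 1)² ≤ a⁴ - 1 = b⁴`. -/
theorem decayWeight_variance_step (n : ℕ) :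
    (1 - decayWeight (n + 1) ^ 2) ^ 2 * decayWeight n ^ 2 + decayWeight (n + 1) ^ 4
      ≤ decayWeight (n + 1) ^ 2 := by
  have h4 := inv_decayWeight_succ_pow_four n
  have hle := inv_decayWeight_le_succ n
  have hb := one_le_inv_decayWeight n
  have hw : decayWeight (n + 1) = (decayWeight (n + 1))⁻¹⁻¹ := (inv_inv _).symm
  have hw' : decayWeight n = (decayWeight n)⁻¹⁻¹ := (inv_inv _).symm
  rw [hw, hw']
  generalize (decayWeight (n + 1))⁻¹ = a at *
  generalize (decayWeight n)⁻¹ = b at *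
  have hb0 : 0 < b := by linarith
  have ha0 : 0 < a := by linarith
  have ha1 : 1 ≤ a ^ 2 := one_le_pow₀ (by linarith)
  have h1 : a ^ 2 - 1 ≤ b ^ 2 := (pow_le_pow_iff_left₀ (by linarith) (sq_nonneg b) two_ne_zero).1 (by nlinarith)
  have h2 : (a ^ 2 - 1) ^ 2 / (a ^ 4 * b ^ 2) ≤ (a ^ 2 - 1) / a ^ 4 := by
    rw [div_le_div_iff₀ (by positivity) (by positivity)]
    have : (a ^ 2 - 1) * (a ^ 2 - 1) ≤ (a ^ 2 - 1) * b ^ 2 := by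
      gcongr
    nlinarith [mul_le_mul_of_nonneg_right this (by positivity : 0 ≤ a ^ 4)]
  have e1 : (1 - a⁻¹ ^ 2) ^ 2 * b⁻¹ ^ 2 = (a ^ 2 - 1) ^ 2 / (a ^ 4 * b ^ 2) := by field_simp
  have e2 : a⁻¹ ^ 2 - a⁻¹ ^ 4 = (a ^ 2 - 1) / a ^ 4 := by field_simp
  linarith

end

/-! ### Deterministic analysis of one trajectory. -/

namespace IsL0L1Smooth

variable {d : ℕ} {L₀ L₁ : ℝ} {F : EuclideanSpace ℝ (Fin d) → ℝ}

theorem norm_normalized_smul_le {η : ℝ} (hη : 0 ≤ η) (m : EuclideanSpace ℝ (Fin d)) :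
    ‖(η / ‖m‖) • m‖ ≤ η := by
  rw [norm_smul, Real.norm_of_nonneg (by positivity)]
  rcases eq_or_ne ‖m‖ 0 with h | h
  · simpa [h] using hη
  · rw [div_mul_cancel₀ _ h]

/-- The error is paid twice: once for replacing `v` by `m` in the inner product, once for replacing
`‖m‖` by `‖v‖`. If `m = 0` the error is `‖v‖` itself, which covers a step that does not move. -/
theorem neg_inner_normalized_le {η : ℝ} (hη : 0 ≤ η) (v m : EuclideanSpace ℝ (Fin d)) :
    -inner ℝ v ((η / ‖m‖) • m) ≤ -(η * ‖v‖) + 2 * η * ‖m - v‖ := by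
  rcases eq_or_ne m 0 with rfl | hm
  · simp
    nlinarith [mul_nonneg hη (norm_nonneg v)]
  · have hm' : 0 < ‖m‖ := norm_pos_iff.2 hm
    have h1 : ‖m‖ ^ 2 - ‖m - v‖ * ‖m‖ ≤ inner ℝ v m := by
      have := real_inner_le_norm (m - v) m
      rw [inner_sub_left, real_inner_self_eq_norm_sq] at this
      linarith
    have h2 : ‖v‖ - ‖m - v‖ ≤ ‖m‖ := by
      have := norm_sub_norm_le v m
      rw [norm_sub_rev] at this
      linarith
    have h3 : η / ‖m‖ * (‖m‖ ^ 2 - ‖m - v‖ * ‖m‖) ≤ η / ‖m‖ * inner ℝ v m := by gcongr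
    have h4 : η / ‖m‖ * (‖m‖ ^ 2 - ‖m - v‖ * ‖m‖) = η * (‖m‖ - ‖m - v‖) := by field_simp
    have h5 : η * (‖v‖ - ‖m - v‖ - ‖m - v‖) ≤ η * (‖m‖ - ‖m - v‖) := by gcongr
    rw [inner_smul_right]
    linarith

/-- Descent along one normalized step in an arbitrary direction `m`. -/
theorem normalized_step_le (hF : IsL0L1Smooth L₀ L₁ F) (hL₀ : 0 ≤ L₀) (hL₁ : 0 ≤ L₁)
    {η : ℝ} (hη : 0 ≤ η) (x m : EuclideanSpace ℝ (Fin d)) :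
    F (x - (η / ‖m‖) • m) ≤ F x - η * ‖gradient F x‖ + 2 * η * ‖m - gradient F x‖
      + (L₀ + L₁ * ‖gradient F x‖) * η ^ 2 * Real.exp (L₁ * η) / 2 := by
  have h := hF.apply_add_le hL₀ hL₁ x (-((η / ‖m‖) • m))
  rw [← sub_eq_add_neg, inner_neg_right, norm_neg] at h
  have h1 := neg_inner_normalized_le hη (gradient F x) m
  have h2 := norm_normalized_smul_le hη m
  have h3 : (L₀ + L₁ * ‖gradient F x‖) * ‖(η / ‖m‖) • m‖ ^ 2
      * Real.exp (L₁ * ‖(η / ‖m‖) • m‖) / 2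
      ≤ (L₀ + L₁ * ‖gradient F x‖) * η ^ 2 * Real.exp (L₁ * η) / 2 := by gcongr
  linarith

variable {X M N γ : ℕ → EuclideanSpace ℝ (Fin d)}

/-- Energy inequality: the momentum error is split into the accumulated noise `N` and a drift,
which is absorbed by a potential. -/
theorem energy_le (hF : IsL0L1Smooth L₀ L₁ F) (hL₀ : 0 ≤ L₀) (hL₁ : 0 ≤ L₁)
    (hM : ∀ k, M (k + 1) = (1 - decayWeight k ^ 2) • M k + decayWeight k ^ 2 • γ k)
    (hN : ∀ k, N (k + 1) = (1 - decayWeight k ^ 2) • N k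
      + decayWeight k ^ 2 • (γ k - gradient F (X k)))
    (hX : ∀ k, X (k + 1) = X k - ((decayWeight k ^ 3 / 7) / ‖M (k + 1)‖) • M (k + 1)) (n : ℕ) :
    F (X n) + ∑ k ∈ Finset.range n, decayWeight k ^ 3 / 7 * ‖gradient F (X k)‖
      + 2 * (decayWeight n * (1 - decayWeight n ^ 4) / 7) * ‖M n - N n - gradient F (X n)‖
    ≤ F (X 0) + ∑ k ∈ Finset.range n, (2 * (decayWeight k ^ 3 / 7) * ‖N (k + 1)‖
      + (L₀ + L₁ * ‖gradient F (X k)‖) * (decayWeight k ^ 6 / 98 + 2 * decayWeight k ^ 4 / 49)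
        * Real.exp (L₁ * (decayWeight k ^ 3 / 7))) := by
  induction n with
  | zero => simp [decayWeight_zero]
  | succ n ih =>
    rw [Finset.sum_range_succ, Finset.sum_range_succ]
    have hw := decayWeight_pos n
    have hw1 := one_sub_decayWeight_sq_nonneg n
    have hstep := hF.normalized_step_le hL₀ hL₁ (η := decayWeight n ^ 3 / 7) (by positivity)
      (X n) (M (n + 1))
    rw [← hX] at hstep
    have hD : M (n + 1) - N (n + 1) - gradient F (X n)
        = (1 - decayWeight n ^ 2) • (M n - N n - gradient F (X n)) := by
      rw [hM, hN]
      module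
    have hDn : ‖M (n + 1) - N (n + 1) - gradient F (X n)‖
        = (1 - decayWeight n ^ 2) * ‖M n - N n - gradient F (X n)‖ := by
      rw [hD, norm_smul, Real.norm_of_nonneg hw1]
    have herr : ‖M (n + 1) - gradient F (X n)‖
        ≤ (1 - decayWeight n ^ 2) * ‖M n - N n - gradient F (X n)‖ + ‖N (n + 1)‖ := by
      rw [← hDn]
      refine le_of_eq_of_le ?_ (norm_add_le _ _)
      congr 1
      abel
    have hS : ‖gradient F (X n) - gradient F (X (n + 1))‖
        ≤ (L₀ + L₁ * ‖gradient F (X n)‖) * (decayWeight n ^ 3 / 7)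
          * Real.exp (L₁ * (decayWeight n ^ 3 / 7)) := by
      have h1 := hF.norm_gradient_add_sub_le hL₀ hL₁ (X n)
        (-(((decayWeight n ^ 3 / 7) / ‖M (n + 1)‖) • M (n + 1)))
      rw [← sub_eq_add_neg, ← hX, norm_neg, norm_sub_rev] at h1
      have h2 := norm_normalized_smul_le (η := decayWeight n ^ 3 / 7) (by positivity) (M (n + 1))
      refine h1.trans ?_
      gcongr
    have hB : ‖M (n + 1) - N (n + 1) - gradient F (X (n + 1))‖
        ≤ (1 - decayWeight n ^ 2) * ‖M n - N n - gradient F (X n)‖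
          + (L₀ + L₁ * ‖gradient F (X n)‖) * (decayWeight n ^ 3 / 7)
            * Real.exp (L₁ * (decayWeight n ^ 3 / 7)) := by
      rw [← hDn]
      refine le_trans (le_of_eq_of_le ?_ (norm_add_le _ _)) (add_le_add le_rfl hS)
      congr 1
      abel
    -- The drift receives the coefficient `2w³/7` from descent and at most `2w/7` from the new
    -- potential, both times `1 - w²`. As `(w + w³)(1 - w²) = w(1 - w⁴)`, this is exactly the old
    -- potential, which vanishes at `n = 0`: the initial error is free.
    have hc : 2 * (decayWeight (n + 1) * (1 - decayWeight (n + 1) ^ 4) / 7)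
        ≤ 2 * (decayWeight n / 7) := by
      have h1 := decayWeight_antitone (Nat.le_succ n)
      have h2 := decayWeight_pos (n + 1)
      have h3 : decayWeight (n + 1) * (1 - decayWeight (n + 1) ^ 4) ≤ decayWeight (n + 1) * 1 := by
        gcongr
        linarith [pow_pos h2 4]
      linarith
    have hpot : 2 * (decayWeight (n + 1) * (1 - decayWeight (n + 1) ^ 4) / 7)
          * ‖M (n + 1) - N (n + 1) - gradient F (X (n + 1))‖
        ≤ 2 * (decayWeight n / 7) * ((1 - decayWeight n ^ 2) * ‖M n - N n - gradient F (X n)‖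
          + (L₀ + L₁ * ‖gradient F (X n)‖) * (decayWeight n ^ 3 / 7)
            * Real.exp (L₁ * (decayWeight n ^ 3 / 7))) :=
      mul_le_mul hc hB (norm_nonneg _) (by positivity)
    have herr' : 2 * (decayWeight n ^ 3 / 7) * ‖M (n + 1) - gradient F (X n)‖
        ≤ 2 * (decayWeight n ^ 3 / 7)
          * ((1 - decayWeight n ^ 2) * ‖M n - N n - gradient F (X n)‖ + ‖N (n + 1)‖) := by gcongr
    nlinarith [hpot, herr', hstep, ih]

theorem norm_sub_zero_le
    (hX : ∀ k, X (k + 1) = X k - ((decayWeight k ^ 3 / 7) / ‖M (k + 1)‖) • M (k + 1)) (n : ℕ) :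
    ‖X n - X 0‖ ≤ ∑ k ∈ Finset.range n, decayWeight k ^ 3 / 7 := by
  induction n with
  | zero => simp
  | succ n ih =>
    rw [Finset.sum_range_succ, hX]
    have h2 := norm_normalized_smul_le (η := decayWeight n ^ 3 / 7)
      (by have := decayWeight_pos n; positivity) (M (n + 1))
    have h3 := norm_sub_le (X n - X 0) (((decayWeight n ^ 3 / 7) / ‖M (n + 1)‖) • M (n + 1))
    rw [sub_right_comm] at h3
    linarith

/-- The travelled distance is at most the sum of the earlier stepsizes. The bound on the sum also
includes stepsize `n`, which pays for the exponential on the left. -/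
theorem norm_gradient_mul_exp_le (hF : IsL0L1Smooth L₀ L₁ F) (hL₀ : 0 ≤ L₀) (hL₁ : 0 ≤ L₁)
    (hX : ∀ k, X (k + 1) = X k - ((decayWeight k ^ 3 / 7) / ‖M (k + 1)‖) • M (k + 1)) (n : ℕ) :
    ‖gradient F (X n)‖ * Real.exp (L₁ * (decayWeight n ^ 3 / 7))
      ≤ (‖gradient F (X 0)‖ + L₀ * (4 / 7 * (decayWeight n)⁻¹))
        * Real.exp (L₁ * (4 / 7 * (decayWeight n)⁻¹)) := by
  have h1 := hF.norm_gradient_add_le hL₀ hL₁ (X 0) (X n - X 0)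
  rw [add_sub_cancel] at h1
  have h2 := norm_sub_zero_le hX n
  have h3 := sum_decayWeight_pow_three_le n
  have h4 : ‖X n - X 0‖ + decayWeight n ^ 3 / 7 ≤ 4 / 7 * (decayWeight n)⁻¹ := by
    rw [← Finset.sum_div] at h2
    rw [Finset.sum_range_succ] at h3
    linarith
  have h0 : 0 ≤ decayWeight n ^ 3 / 7 := by have := decayWeight_pos n; positivity
  calc _ ≤ (‖gradient F (X 0)‖ + L₀ * ‖X n - X 0‖) * Real.exp (L₁ * ‖X n - X 0‖)
        * Real.exp (L₁ * (decayWeight n ^ 3 / 7)) := by gcongr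
    _ = (‖gradient F (X 0)‖ + L₀ * ‖X n - X 0‖)
        * Real.exp (L₁ * (‖X n - X 0‖ + decayWeight n ^ 3 / 7)) := by
        rw [mul_add, Real.exp_add, mul_assoc]
    _ ≤ _ := by
        have h5 : ‖X n - X 0‖ ≤ 4 / 7 * (decayWeight n)⁻¹ := by linarith
        have h6 := norm_nonneg (gradient F (X 0))
        have h7 := norm_nonneg (X n - X 0)
        exact mul_le_mul (by gcongr) (by gcongr) (Real.exp_pos _).le
          (add_nonneg h6 (mul_nonneg hL₀ (h7.trans h5)))

/-- The gradient part of the remainder: beyond the time `t = L₁⁴` it is at most half of the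
progress, before it the gradient is controlled by the one at the starting point. -/
theorem gradient_remainder_le (hF : IsL0L1Smooth L₀ L₁ F) (hL₀ : 0 ≤ L₀) (hL₁ : 0 ≤ L₁)
    (hX : ∀ k, X (k + 1) = X k - ((decayWeight k ^ 3 / 7) / ‖M (k + 1)‖) • M (k + 1)) (n : ℕ) :
    L₁ * ‖gradient F (X n)‖ * (decayWeight n ^ 6 / 98 + 2 * decayWeight n ^ 4 / 49)
        * Real.exp (L₁ * (decayWeight n ^ 3 / 7))
      ≤ decayWeight n ^ 3 / 7 * ‖gradient F (X n)‖ / 2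
        + 5 / 98 * L₁ * Real.exp (4 / 7 * L₁ ^ 2) * (‖gradient F (X 0)‖ + 4 / 7 * L₀)
          * (if 1 < L₁ * decayWeight n then decayWeight n ^ 3 else 0) := by
  have hw := decayWeight_pos n
  have hw1 := decayWeight_le_one n
  have hG := norm_nonneg (gradient F (X n))
  have hcoef : decayWeight n ^ 6 / 98 + 2 * decayWeight n ^ 4 / 49 ≤ 5 / 98 * decayWeight n ^ 4 := by
    have := pow_le_pow_of_le_one hw.le hw1 (by norm_num : 4 ≤ 6)
    linarith
  have hfirst : L₁ * ‖gradient F (X n)‖ * (decayWeight n ^ 6 / 98 + 2 * decayWeight n ^ 4 / 49)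
        * Real.exp (L₁ * (decayWeight n ^ 3 / 7))
      ≤ L₁ * ‖gradient F (X n)‖ * (5 / 98 * decayWeight n ^ 4)
        * Real.exp (L₁ * (decayWeight n ^ 3 / 7)) := by gcongr
  refine hfirst.trans ?_
  split_ifs with h
  -- Early phase: the inverse weight is at most `L₁`, and one of the four factors `w` cancels the
  -- inverse weight multiplying `L₀`.
  · have h1 := hF.norm_gradient_mul_exp_le hL₀ hL₁ hX n
    have hinv : (decayWeight n)⁻¹ ≤ L₁ := by
      rw [inv_le_iff_one_le_mul₀ hw]
      exact h.le
    have hexp : Real.exp (L₁ * (4 / 7 * (decayWeight n)⁻¹)) ≤ Real.exp (4 / 7 * L₁ ^ 2) := by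
      apply Real.exp_le_exp.2
      nlinarith [mul_le_mul_of_nonneg_left hinv hL₁]
    have hprod : decayWeight n * (‖gradient F (X 0)‖ + L₀ * (4 / 7 * (decayWeight n)⁻¹))
        ≤ ‖gradient F (X 0)‖ + 4 / 7 * L₀ := by
      have e : decayWeight n * (‖gradient F (X 0)‖ + L₀ * (4 / 7 * (decayWeight n)⁻¹))
        = decayWeight n * ‖gradient F (X 0)‖ + 4 / 7 * L₀ := by field_simp
      rw [e]
      nlinarith [norm_nonneg (gradient F (X 0))]
    calc L₁ * ‖gradient F (X n)‖ * (5 / 98 * decayWeight n ^ 4)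
          * Real.exp (L₁ * (decayWeight n ^ 3 / 7))
        = 5 / 98 * L₁ * decayWeight n ^ 4
          * (‖gradient F (X n)‖ * Real.exp (L₁ * (decayWeight n ^ 3 / 7))) := by ring
      _ ≤ 5 / 98 * L₁ * decayWeight n ^ 4
          * ((‖gradient F (X 0)‖ + L₀ * (4 / 7 * (decayWeight n)⁻¹))
            * Real.exp (4 / 7 * L₁ ^ 2)) := by
          have := h1.trans (mul_le_mul_of_nonneg_left hexp (by positivity))
          gcongr
      _ = 5 / 98 * L₁ * Real.exp (4 / 7 * L₁ ^ 2)
          * (decayWeight n * (‖gradient F (X 0)‖ + L₀ * (4 / 7 * (decayWeight n)⁻¹)))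
            * decayWeight n ^ 3 := by ring
      _ ≤ 5 / 98 * L₁ * Real.exp (4 / 7 * L₁ ^ 2) * (‖gradient F (X 0)‖ + 4 / 7 * L₀)
            * decayWeight n ^ 3 := by gcongr
      _ ≤ _ := by
        have : 0 ≤ decayWeight n ^ 3 / 7 * ‖gradient F (X n)‖ / 2 := by positivity
        linarith
  -- Late phase: `L₁ w ≤ 1` absorbs one factor `w`, and `5/98 * 7/6 ≤ 1/14`.
  · push Not at h
    have hexp : Real.exp (L₁ * (decayWeight n ^ 3 / 7)) ≤ 7 / 6 := by
      have h1 : L₁ * (decayWeight n ^ 3 / 7) ≤ 1 / 7 := by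
        have : decayWeight n ^ 3 ≤ decayWeight n := pow_le_of_le_one hw.le hw1 (by norm_num)
        nlinarith
      refine (Real.exp_le_exp.2 h1).trans ?_
      have := Real.exp_bound_div_one_sub_of_interval (x := 1 / 7) (by norm_num) (by norm_num)
      norm_num at this ⊢
      linarith
    calc L₁ * ‖gradient F (X n)‖ * (5 / 98 * decayWeight n ^ 4)
          * Real.exp (L₁ * (decayWeight n ^ 3 / 7))
        = 5 / 98 * decayWeight n ^ 3 * ‖gradient F (X n)‖ * (L₁ * decayWeight n)
          * Real.exp (L₁ * (decayWeight n ^ 3 / 7)) := by ring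
      _ ≤ 5 / 98 * decayWeight n ^ 3 * ‖gradient F (X n)‖ * 1 * (7 / 6) := by gcongr
      _ ≤ _ := by
        have : 0 ≤ decayWeight n ^ 3 * ‖gradient F (X n)‖ := by positivity
        linarith

/-- The chord bound for the convex exponential keeps `exp (L / 7)` off the `w⁴` term, whose sum is
logarithmic; it multiplies only the summable `w⁶`. -/
theorem exp_remainder_le (L : ℝ) (hL : 0 ≤ L) (k : ℕ) :
    (decayWeight k ^ 6 / 98 + 2 * decayWeight k ^ 4 / 49) * Real.exp (L * (decayWeight k ^ 3 / 7))
      ≤ 5 / 98 * Real.exp (L / 7) * decayWeight k ^ 6 + 2 / 49 * decayWeight k ^ 4 := by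
  have hw := decayWeight_pos k
  have hw1 := decayWeight_le_one k
  have h3 : decayWeight k ^ 3 ≤ 1 := pow_le_one₀ hw.le hw1
  have hE0 := Real.exp_pos (L / 7)
  have h1 : Real.exp (L * (decayWeight k ^ 3 / 7)) ≤ Real.exp (L / 7) := by
    apply Real.exp_le_exp.2
    nlinarith
  have h2 : Real.exp (L * (decayWeight k ^ 3 / 7)) ≤ 1 + decayWeight k ^ 3 * Real.exp (L / 7) := by
    have h := convexOn_exp.2 (Set.mem_univ 0) (Set.mem_univ (L / 7))
      (sub_nonneg.2 h3) (by positivity : 0 ≤ decayWeight k ^ 3) (by ring)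
    simp only [smul_eq_mul, mul_zero, zero_add, Real.exp_zero, mul_one] at h
    have e : L * (decayWeight k ^ 3 / 7) = decayWeight k ^ 3 * (L / 7) := by ring
    rw [e]
    have : 0 < decayWeight k ^ 3 := by positivity
    linarith
  have h4 : decayWeight k ^ 6 * Real.exp (L * (decayWeight k ^ 3 / 7))
      ≤ decayWeight k ^ 6 * Real.exp (L / 7) := by gcongr
  have h5 : decayWeight k ^ 4 * Real.exp (L * (decayWeight k ^ 3 / 7))
      ≤ decayWeight k ^ 4 * (1 + decayWeight k ^ 3 * Real.exp (L / 7)) := by gcongr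
  have h6 : decayWeight k ^ 7 * Real.exp (L / 7) ≤ decayWeight k ^ 6 * Real.exp (L / 7) := by
    have := pow_le_pow_of_le_one hw.le hw1 (by norm_num : 6 ≤ 7)
    gcongr
  nlinarith

/-- The weighted sum of gradient norms along one trajectory of NSGD-M. -/
theorem sum_norm_gradient_le (hF : IsL0L1Smooth L₀ L₁ F) (hL₀ : 0 ≤ L₀) (hL₁ : 0 ≤ L₁)
    {Fstar : ℝ} (hlower : ∀ x, Fstar ≤ F x)
    (hM : ∀ k, M (k + 1) = (1 - decayWeight k ^ 2) • M k + decayWeight k ^ 2 • γ k)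
    (hN : ∀ k, N (k + 1) = (1 - decayWeight k ^ 2) • N k
      + decayWeight k ^ 2 • (γ k - gradient F (X k)))
    (hX : ∀ k, X (k + 1) = X k - ((decayWeight k ^ 3 / 7) / ‖M (k + 1)‖) • M (k + 1)) (n : ℕ) :
    ∑ k ∈ Finset.range n, decayWeight k ^ 3 / 7 * ‖gradient F (X k)‖
      ≤ 2 * (F (X 0) - Fstar)
        + 4 * ∑ k ∈ Finset.range n, decayWeight k ^ 3 / 7 * ‖N (k + 1)‖
        + L₀ * (15 / 49 * Real.exp (L₁ / 7) + 4 / 49 * (1 + Real.log n))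
        + 20 / 49 * L₁ ^ 2 * Real.exp (4 / 7 * L₁ ^ 2)
          * (‖gradient F (X 0)‖ + 4 / 7 * L₀) := by
  have h := hF.energy_le hL₀ hL₁ hM hN hX n
  have hpot : 0 ≤ 2 * (decayWeight n * (1 - decayWeight n ^ 4) / 7)
      * ‖M n - N n - gradient F (X n)‖ := by
    have h1 := decayWeight_pos n
    have h2 := sub_nonneg.2 (pow_le_one₀ (n := 4) h1.le (decayWeight_le_one n))
    positivity
  set K := 5 / 98 * L₁ * Real.exp (4 / 7 * L₁ ^ 2) * (‖gradient F (X 0)‖ + 4 / 7 * L₀) with hK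
  have hK0 : 0 ≤ K := by positivity
  have hterm (k : ℕ) : 2 * (decayWeight k ^ 3 / 7) * ‖N (k + 1)‖
      + (L₀ + L₁ * ‖gradient F (X k)‖) * (decayWeight k ^ 6 / 98 + 2 * decayWeight k ^ 4 / 49)
        * Real.exp (L₁ * (decayWeight k ^ 3 / 7))
      ≤ 2 * (decayWeight k ^ 3 / 7 * ‖N (k + 1)‖)
        + L₀ * (5 / 98 * Real.exp (L₁ / 7) * decayWeight k ^ 6 + 2 / 49 * decayWeight k ^ 4)
        + 1 / 2 * (decayWeight k ^ 3 / 7 * ‖gradient F (X k)‖)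
        + K * (if 1 < L₁ * decayWeight k then decayWeight k ^ 3 else 0) := by
    have h1 := hF.gradient_remainder_le hL₀ hL₁ hX k
    have h2 := mul_le_mul_of_nonneg_left (exp_remainder_le L₁ hL₁ k) hL₀
    rw [← hK] at h1
    linarith
  have hsum := Finset.sum_le_sum fun k (_ : k ∈ Finset.range n) => hterm k
  simp only [Finset.sum_add_distrib, ← Finset.mul_sum] at hsum h
  have h3 := mul_le_mul_of_nonneg_left (sum_ite_decayWeight_pow_three_le hL₁ n) hK0
  have h4 : L₀ * (5 / 98 * Real.exp (L₁ / 7) * ∑ k ∈ Finset.range n, decayWeight k ^ 6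
      + 2 / 49 * ∑ k ∈ Finset.range n, decayWeight k ^ 4)
      ≤ L₀ * (5 / 98 * Real.exp (L₁ / 7) * 3 + 2 / 49 * (1 + Real.log n)) := by
    have := sum_decayWeight_pow_six_le n
    have := sum_decayWeight_pow_four_le n
    gcongr
  -- The factor 2 comes from moving half of the weighted gradient sum to the left side.
  have h5 : K * (4 * L₁) * 2 = 20 / 49 * L₁ ^ 2 * Real.exp (4 / 7 * L₁ ^ 2)
          * (‖gradient F (X 0)‖ + 4 / 7 * L₀) := by rw [hK]; ring
  have h6 := hlower (X n)
  linarith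

end IsL0L1Smooth

/-! ### Measurability, independence and second moment of the averaged noise. -/

noncomputable section

/-- The exponentially averaged gradient noise `N_k` of NSGD-M: `N_0 = 0` and
`N_t = β_t N_{t-1} + (1 - β_t) (∇f(x_t, ξ_t) - ∇F(x_t))`. -/
def nsgdmNoise {d : ℕ} {Ξ : Type*} (β η : ℕ → ℝ) (F : EuclideanSpace ℝ (Fin d) → ℝ)
    (g : EuclideanSpace ℝ (Fin d) → Ξ → EuclideanSpace ℝ (Fin d))
    (x₁ : EuclideanSpace ℝ (Fin d)) (s : ℕ → Ξ) : ℕ → EuclideanSpace ℝ (Fin d)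
  | 0 => 0
  | k + 1 => β (k + 1) • nsgdmNoise β η F g x₁ s k + (1 - β (k + 1)) •
      (g (nsgdmState β η g x₁ s k).1 (s k) - gradient F (nsgdmState β η g x₁ s k).1)

variable {d : ℕ} {Ω Ξ : Type*} [MeasurableSpace Ξ] {β η : ℕ → ℝ}
  {F : EuclideanSpace ℝ (Fin d) → ℝ}
  {g : EuclideanSpace ℝ (Fin d) → Ξ → EuclideanSpace ℝ (Fin d)}
  {ξ : ℕ → Ω → Ξ}

/-- The state after `k` steps is measurable with respect to the first `k` samples. -/
theorem measurable_nsgdmState [MeasurableSpace Ω] (hg : Measurable (Function.uncurry g))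
    (x₁ : EuclideanSpace ℝ (Fin d)) (k : ℕ) (hξ : ∀ i < k, Measurable (ξ i)) :
    Measurable fun ω => nsgdmState β η g x₁ (fun i => ξ i ω) k := by
  induction k with
  | zero => exact measurable_const
  | succ k ih =>
    have h := ih fun i hi => hξ i (hi.trans (Nat.lt_succ_self k))
    have hx := h.fst
    have hm := h.snd
    have hγ := hg.comp (hx.prodMk (hξ k (Nat.lt_succ_self k)))
    simp only [Function.comp_def, Function.uncurry] at hγ
    have hm' := (hm.const_smul (β (k + 1))).add (hγ.const_smul (1 - β (k + 1)))
    simp only [nsgdmState]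
    exact (hx.sub ((hm'.norm.const_div (η (k + 1))).smul hm')).prodMk hm'

theorem measurable_nsgdmNoise [MeasurableSpace Ω] (hg : Measurable (Function.uncurry g))
    (hF : Measurable (gradient F)) (x₁ : EuclideanSpace ℝ (Fin d)) (k : ℕ)
    (hξ : ∀ i < k, Measurable (ξ i)) :
    Measurable fun ω => nsgdmNoise β η F g x₁ (fun i => ξ i ω) k := by
  induction k with
  | zero => exact measurable_const
  | succ k ih =>
    have hk : ∀ i < k, Measurable (ξ i) := fun i hi => hξ i (hi.trans (Nat.lt_succ_self k))
    have hN := ih hk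
    have hx := (measurable_nsgdmState (β := β) (η := η) hg x₁ k hk).fst
    have hγ := hg.comp (hx.prodMk (hξ k (Nat.lt_succ_self k)))
    have hG := hF.comp hx
    simp only [Function.comp_def, Function.uncurry] at hγ hG
    exact (hN.const_smul (β (k + 1))).add ((hγ.sub hG).const_smul (1 - β (k + 1)))

/-- The state and the noise before step `k` are independent of the sample drawn at step `k`. -/
theorem indepFun_nsgdmState_nsgdmNoise [MeasurableSpace Ω] {P : Measure Ω}
    (hg : Measurable (Function.uncurry g)) (hF : Measurable (gradient F))
    (hξ : ∀ k, Measurable (ξ k)) (hindep : iIndepFun ξ P) (x₁ : EuclideanSpace ℝ (Fin d)) (k : ℕ) :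
    IndepFun (fun ω => ((nsgdmState β η g x₁ (fun i => ξ i ω) k).1,
      nsgdmNoise β η F g x₁ (fun i => ξ i ω) k)) (ξ k) P := by
  rw [IndepFun_iff_Indep]
  have h := indep_iSup_of_disjoint (m := fun i => MeasurableSpace.comap (ξ i) inferInstance)
    (fun i => (hξ i).comap_le) hindep (S := Set.Iio k) (T := {k}) (by simp)
  refine indep_of_indep_of_le_left (indep_of_indep_of_le_right h ?_) ?_
  · exact le_iSup₂_of_le k rfl le_rfl
  · rw [← measurable_iff_comap_le]
    have hξ' : ∀ i < k, Measurable[⨆ i ∈ Set.Iio k, MeasurableSpace.comap (ξ i) inferInstance]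
        (ξ i) := fun i hi =>
      Measurable.of_comap_le (le_iSup₂_of_le (f := fun i (_ : i ∈ Set.Iio k) =>
        MeasurableSpace.comap (ξ i) inferInstance) i hi le_rfl)
    -- Measurability is now taken with respect to the past samples only.
    let _ : MeasurableSpace Ω := ⨆ i ∈ Set.Iio k, MeasurableSpace.comap (ξ i) inferInstance
    exact (measurable_nsgdmState hg x₁ k hξ').fst.prodMk (measurable_nsgdmNoise hg hF x₁ k hξ')

/-- Adding a fresh centred error to a fixed vector adds the second moments. -/
theorem IsBoundedVarianceOracle.lintegral_norm_sq_le {D : Measure Ξ} [IsProbabilityMeasure D]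
    {σ : ℝ} (hg : IsBoundedVarianceOracle F D σ g) (a b : ℝ) (x n : EuclideanSpace ℝ (Fin d)) :
    ∫⁻ z, ENNReal.ofReal (‖a • n + b • (g x z - gradient F x)‖ ^ 2) ∂D
      ≤ ENNReal.ofReal (a ^ 2 * ‖n‖ ^ 2 + b ^ 2 * σ ^ 2) := by
  have hi : Integrable (fun z => g x z - gradient F x) D :=
    (hg.integrable x).sub (integrable_const _)
  have hz : ∫ z, (g x z - gradient F x) ∂D = 0 := by
    rw [integral_sub (hg.integrable x) (integrable_const _), hg.unbiased]
    simp
  have hinner : Integrable (fun z => inner ℝ n (g x z - gradient F x)) D := hi.const_inner n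
  have e (z : Ξ) : ‖a • n + b • (g x z - gradient F x)‖ ^ 2
      = a ^ 2 * ‖n‖ ^ 2 + 2 * a * b * inner ℝ n (g x z - gradient F x)
        + b ^ 2 * ‖g x z - gradient F x‖ ^ 2 := by
    rw [norm_add_sq_real, norm_smul, norm_smul, mul_pow, mul_pow, inner_smul_left,
      inner_smul_right]
    simp
    ring
  have h1 : Integrable (fun z => a ^ 2 * ‖n‖ ^ 2
      + 2 * a * b * inner ℝ n (g x z - gradient F x)) D :=
    (integrable_const _).add (hinner.const_mul _)
  have h2 : Integrable (fun z => b ^ 2 * ‖g x z - gradient F x‖ ^ 2) D :=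
    (hg.integrable_sq x).const_mul _
  rw [← ofReal_integral_eq_lintegral_ofReal (by simp only [e]; exact h1.add h2)
    (Filter.Eventually.of_forall fun z => by positivity)]
  apply ENNReal.ofReal_le_ofReal
  simp only [e]
  rw [integral_add h1 h2, integral_add (integrable_const _) (hinner.const_mul _),
    integral_const, integral_const_mul, integral_const_mul, integral_inner hi, hz]
  have := mul_le_mul_of_nonneg_left (hg.variance_le x) (sq_nonneg b)
  simpa using this

variable [MeasurableSpace Ω] {P : Measure Ω} [IsProbabilityMeasure P]
  {D : Measure Ξ} [IsProbabilityMeasure D] {σ : ℝ}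

/-- By independence the sample can be integrated out with the past frozen. Lower integrals are used
since square integrability is a consequence of this recursion. -/
theorem lintegral_nsgdmNoise_succ_le (hF : Measurable (gradient F))
    (hg : IsBoundedVarianceOracle F D σ g) (hξ : ∀ k, Measurable (ξ k))
    (hlaw : ∀ k, P.map (ξ k) = D) (hindep : iIndepFun ξ P)
    (x₁ : EuclideanSpace ℝ (Fin d)) (k : ℕ) :
    ∫⁻ ω, ENNReal.ofReal (‖nsgdmNoise β η F g x₁ (fun i => ξ i ω) (k + 1)‖ ^ 2) ∂P
      ≤ ENNReal.ofReal (β (k + 1) ^ 2)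
        * ∫⁻ ω, ENNReal.ofReal (‖nsgdmNoise β η F g x₁ (fun i => ξ i ω) k‖ ^ 2) ∂P
        + ENNReal.ofReal ((1 - β (k + 1)) ^ 2 * σ ^ 2) := by
  set H : Ω → EuclideanSpace ℝ (Fin d) × EuclideanSpace ℝ (Fin d) := fun ω =>
    ((nsgdmState β η g x₁ (fun i => ξ i ω) k).1, nsgdmNoise β η F g x₁ (fun i => ξ i ω) k) with hH
  have hHm : Measurable H :=
    (measurable_nsgdmState hg.measurable x₁ k fun i _ => hξ i).fst.prodMk
      (measurable_nsgdmNoise hg.measurable hF x₁ k fun i _ => hξ i)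
  have hind : IndepFun H (ξ k) P :=
    indepFun_nsgdmState_nsgdmNoise hg.measurable hF hξ hindep x₁ k
  have hmap := hind.map_prod_eq_prod_map_map hHm.aemeasurable (hξ k).aemeasurable
  rw [hlaw] at hmap
  have : IsProbabilityMeasure (P.map H) := Measure.isProbabilityMeasure_map hHm.aemeasurable
  set q : (EuclideanSpace ℝ (Fin d) × EuclideanSpace ℝ (Fin d)) × Ξ → ENNReal := fun p =>
    ENNReal.ofReal (‖β (k + 1) • p.1.2 + (1 - β (k + 1)) •
      (g p.1.1 p.2 - gradient F p.1.1)‖ ^ 2) with hq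
  have hgm : Measurable fun p : (EuclideanSpace ℝ (Fin d) × EuclideanSpace ℝ (Fin d)) × Ξ =>
      g p.1.1 p.2 := hg.measurable.comp (measurable_fst.fst.prodMk measurable_snd)
  have hqm : Measurable q := by
    refine ENNReal.measurable_ofReal.comp (Measurable.pow_const (Measurable.norm ?_) 2)
    have hG : Measurable fun p : (EuclideanSpace ℝ (Fin d) × EuclideanSpace ℝ (Fin d)) × Ξ =>
      gradient F p.1.1 := hF.comp measurable_fst.fst
    exact (measurable_fst.snd.const_smul (β (k + 1))).add
      ((hgm.sub hG).const_smul (1 - β (k + 1)))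
  calc ∫⁻ ω, ENNReal.ofReal (‖nsgdmNoise β η F g x₁ (fun i => ξ i ω) (k + 1)‖ ^ 2) ∂P
      = ∫⁻ ω, q (H ω, ξ k ω) ∂P := rfl
    _ = ∫⁻ h, ∫⁻ z, q (h, z) ∂D ∂(P.map H) := by
        rw [← lintegral_prod _ hqm.aemeasurable, ← hmap,
          lintegral_map hqm (hHm.prodMk (hξ k))]
    _ ≤ ∫⁻ h, ENNReal.ofReal (β (k + 1) ^ 2 * ‖h.2‖ ^ 2 + (1 - β (k + 1)) ^ 2 * σ ^ 2)
          ∂(P.map H) :=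
        lintegral_mono fun h => hg.lintegral_norm_sq_le _ _ h.1 h.2
    _ = ∫⁻ ω, ENNReal.ofReal (β (k + 1) ^ 2 * ‖(H ω).2‖ ^ 2 + (1 - β (k + 1)) ^ 2 * σ ^ 2) ∂P :=
        lintegral_map (by fun_prop) hHm
    _ = ∫⁻ ω, (ENNReal.ofReal (β (k + 1) ^ 2) * ENNReal.ofReal (‖(H ω).2‖ ^ 2)
          + ENNReal.ofReal ((1 - β (k + 1)) ^ 2 * σ ^ 2)) ∂P := by
        congr 1 with ω
        rw [ENNReal.ofReal_add (by positivity) (by positivity),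
          ENNReal.ofReal_mul (by positivity)]
    _ = _ := by
        have hm : Measurable fun ω => ENNReal.ofReal (‖(H ω).2‖ ^ 2) :=
          ENNReal.measurable_ofReal.comp (hHm.snd.norm.pow_const 2)
        rw [lintegral_add_right _ measurable_const, lintegral_const_mul _ hm]
        simp [hH]

theorem lintegral_nsgdmNoise_sq_le (hF : Measurable (gradient F))
    (hg : IsBoundedVarianceOracle F D σ g) (hξ : ∀ k, Measurable (ξ k))
    (hlaw : ∀ k, P.map (ξ k) = D) (hindep : iIndepFun ξ P)
    (x₁ : EuclideanSpace ℝ (Fin d)) (k : ℕ) :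
    ∫⁻ ω, ENNReal.ofReal (‖nsgdmNoise agnosticMomentum η F g x₁ (fun i => ξ i ω) (k + 1)‖ ^ 2) ∂P
      ≤ ENNReal.ofReal (σ ^ 2 * decayWeight k ^ 2) := by
  induction k with
  | zero =>
    refine (lintegral_nsgdmNoise_succ_le hF hg hξ hlaw hindep x₁ 0).trans ?_
    -- Here `β_1 = 0` and the initial noise is zero, so the bound is `σ²`.
    simp [agnosticMomentum, nsgdmNoise, decayWeight_zero]
  | succ k ih =>
    refine (lintegral_nsgdmNoise_succ_le hF hg hξ hlaw hindep x₁ (k + 1)).trans ?_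
    refine (add_le_add (mul_le_mul_right ih _) le_rfl).trans ?_
    rw [← ENNReal.ofReal_mul (by positivity), ← ENNReal.ofReal_add (by positivity) (by positivity),
      agnosticMomentum_succ]
    apply ENNReal.ofReal_le_ofReal
    nlinarith [mul_le_mul_of_nonneg_left (decayWeight_variance_step k) (sq_nonneg σ)]

theorem memLp_nsgdmNoise (hF : Measurable (gradient F))
    (hg : IsBoundedVarianceOracle F D σ g) (hξ : ∀ k, Measurable (ξ k))
    (hlaw : ∀ k, P.map (ξ k) = D) (hindep : iIndepFun ξ P)
    (x₁ : EuclideanSpace ℝ (Fin d)) (k : ℕ) :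
    MemLp (fun ω => ‖nsgdmNoise agnosticMomentum η F g x₁ (fun i => ξ i ω) (k + 1)‖) 2 P := by
  have hm := (measurable_nsgdmNoise (β := agnosticMomentum) (η := η) hg.measurable hF x₁ (k + 1)
    fun i _ => hξ i).norm
  rw [memLp_two_iff_integrable_sq hm.aestronglyMeasurable]
  refine ⟨(hm.pow_const 2).aestronglyMeasurable, ?_⟩
  rw [hasFiniteIntegral_iff_ofReal (Filter.Eventually.of_forall fun ω => by positivity)]
  exact (lintegral_nsgdmNoise_sq_le hF hg hξ hlaw hindep x₁ k).trans_lt ENNReal.ofReal_lt_top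

/-- The accumulated noise at time `t = k + 1` is at most `σ t^{-1/4}` in mean. -/
theorem integral_norm_nsgdmNoise_le (hF : Measurable (gradient F)) (hσ : 0 ≤ σ)
    (hg : IsBoundedVarianceOracle F D σ g) (hξ : ∀ k, Measurable (ξ k))
    (hlaw : ∀ k, P.map (ξ k) = D) (hindep : iIndepFun ξ P)
    (x₁ : EuclideanSpace ℝ (Fin d)) (k : ℕ) :
    ∫ ω, ‖nsgdmNoise agnosticMomentum η F g x₁ (fun i => ξ i ω) (k + 1)‖ ∂P
      ≤ σ * decayWeight k := by
  have hL := memLp_nsgdmNoise (η := η) hF hg hξ hlaw hindep x₁ k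
  -- Nonnegative variance supplies `(E‖N‖)² ≤ E‖N‖²`.
  have hv := variance_nonneg
    (fun ω => ‖nsgdmNoise agnosticMomentum η F g x₁ (fun i => ξ i ω) (k + 1)‖) P
  rw [variance_eq_sub hL] at hv
  have hsq : ∫ ω, ‖nsgdmNoise agnosticMomentum η F g x₁ (fun i => ξ i ω) (k + 1)‖ ^ 2 ∂P
      ≤ σ ^ 2 * decayWeight k ^ 2 := by
    rw [← ENNReal.ofReal_le_ofReal_iff (by positivity),
      ofReal_integral_eq_lintegral_ofReal hL.integrable_sq
        (Filter.Eventually.of_forall fun ω => by positivity)]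
    exact lintegral_nsgdmNoise_sq_le hF hg hξ hlaw hindep x₁ k
  have hw := decayWeight_pos k
  refine (pow_le_pow_iff_left₀ (integral_nonneg fun ω => norm_nonneg _) (by positivity)
    two_ne_zero).1 ?_
  rw [mul_pow]
  refine le_trans ?_ hsq
  simpa using hv

end

/-! ### Exponential inequalities and passage to the plain average. -/

theorem mul_exp_le_exp {x : ℝ} (hx : 0 ≤ x) :
    x * Real.exp (4 / 7 * x) ≤ 7 / 6 * Real.exp x := by
  have h := Real.quadratic_le_exp_of_nonneg (x := 3 / 7 * x) (by positivity)
  have h1 : x ≤ 7 / 6 * Real.exp (3 / 7 * x) := by nlinarith [sq_nonneg (3 / 7 * x - 1)]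
  calc x * Real.exp (4 / 7 * x) ≤ 7 / 6 * Real.exp (3 / 7 * x) * Real.exp (4 / 7 * x) := by gcongr
    _ = 7 / 6 * Real.exp x := by
      rw [mul_assoc, ← Real.exp_add]
      ring_nf

theorem sq_mul_exp_le_exp {x : ℝ} (hx : 12 ≤ x) :
    x ^ 2 * Real.exp (4 / 7 * x) ≤ 49 / 10 * Real.exp x := by
  have h := Real.quadratic_le_exp_of_nonneg (x := 3 / 14 * x) (by positivity)
  have h0 : 0.47 * x ≤ Real.exp (3 / 14 * x) := by nlinarith
  have h1 : x ^ 2 ≤ 49 / 10 * Real.exp (3 / 7 * x) := by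
    have e : Real.exp (3 / 7 * x) = Real.exp (3 / 14 * x) ^ 2 := by
      rw [← Real.exp_nat_mul]
      ring_nf
    rw [e]
    nlinarith
  calc x ^ 2 * Real.exp (4 / 7 * x)
      ≤ 49 / 10 * Real.exp (3 / 7 * x) * Real.exp (4 / 7 * x) := by gcongr
    _ = 49 / 10 * Real.exp x := by
      rw [mul_assoc, ← Real.exp_add]
      ring_nf

theorem minRatioSqrt_nonneg {L₀ L₁ : ℝ} (hL₀ : 0 ≤ L₀) (hL₁ : 0 ≤ L₁) (Δ : ℝ) :
    0 ≤ minRatioSqrt L₀ L₁ Δ := by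
  unfold minRatioSqrt
  split_ifs <;> positivity

theorem minRatioSqrt_le_of_le {L₀ L₁ : ℝ} (hL₀ : 0 ≤ L₀) (hL : 7 / 2 ≤ L₁) (Δ : ℝ) :
    minRatioSqrt L₀ L₁ Δ ≤ 2 / 7 * L₀ := by
  have h0 : 0 < L₁ := by linarith
  rw [minRatioSqrt, if_neg h0.ne']
  refine (min_le_left _ _).trans ?_
  rw [div_le_iff₀ h0]
  nlinarith

/-- A bound on the stepsize-weighted sum yields a bound on the plain average. -/
theorem average_le_of_weighted_sum_le {a : ℕ → ℝ} (ha : ∀ k, 0 ≤ a k) {n : ℕ} {B : ℝ}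
    (h : ∑ k ∈ Finset.range (n + 1), decayWeight k ^ 3 / 7 * a k ≤ B) :
    1 / ((n + 1 : ℕ) : ℝ) * ∑ k ∈ Finset.range (n + 1), a k
      ≤ 7 * B / ((n + 1 : ℕ) : ℝ) ^ (1 / 4 : ℝ) := by
  have hw := decayWeight_pos n
  have e1 : ((n + 1 : ℕ) : ℝ) = (decayWeight n ^ 4)⁻¹ := by
    rw [decayWeight_pow_four, inv_inv]
    push_cast
    rfl
  have e2 : ((n + 1 : ℕ) : ℝ) ^ (1 / 4 : ℝ) = (decayWeight n)⁻¹ := by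
    rw [decayWeight, ← Real.rpow_neg (by positivity)]
    norm_num
  rw [e2, e1]
  -- The last weight is the smallest; multiplying by `7 w` turns `w³/7` into `w⁴ = 1/T`.
  have h1 : decayWeight n ^ 3 / 7 * ∑ k ∈ Finset.range (n + 1), a k ≤ B := by
    refine le_trans ?_ h
    rw [Finset.mul_sum]
    refine Finset.sum_le_sum fun k hk => ?_
    have := decayWeight_antitone (Nat.lt_succ_iff.1 (Finset.mem_range.1 hk))
    have := ha k
    gcongr
  have h2 := mul_le_mul_of_nonneg_left h1 (mul_nonneg (by norm_num : (0 : ℝ) ≤ 7) hw.le)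
  rw [div_inv_eq_mul, div_inv_eq_mul]
  linarith

/-! ### The algorithm written with the weights, and the bound in expectation. -/

section Recursion

variable {d : ℕ} {Ξ : Type*} {F : EuclideanSpace ℝ (Fin d) → ℝ}
  {g : EuclideanSpace ℝ (Fin d) → Ξ → EuclideanSpace ℝ (Fin d)}

theorem nsgdmState_fst_succ (x₁ : EuclideanSpace ℝ (Fin d)) (s : ℕ → Ξ) (k : ℕ) :
    (nsgdmState agnosticMomentum agnosticStepsize g x₁ s (k + 1)).1
      = (nsgdmState agnosticMomentum agnosticStepsize g x₁ s k).1
        - ((decayWeight k ^ 3 / 7)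
            / ‖(nsgdmState agnosticMomentum agnosticStepsize g x₁ s (k + 1)).2‖)
          • (nsgdmState agnosticMomentum agnosticStepsize g x₁ s (k + 1)).2 := by
  rw [← agnosticStepsize_succ]
  rfl

theorem nsgdmState_snd_succ {η : ℕ → ℝ} (x₁ : EuclideanSpace ℝ (Fin d)) (s : ℕ → Ξ) (k : ℕ) :
    (nsgdmState agnosticMomentum η g x₁ s (k + 1)).2
      = (1 - decayWeight k ^ 2) • (nsgdmState agnosticMomentum η g x₁ s k).2
        + decayWeight k ^ 2 • g (nsgdmState agnosticMomentum η g x₁ s k).1 (s k) := by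
  have h : decayWeight k ^ 2 = 1 - agnosticMomentum (k + 1) := by rw [agnosticMomentum_succ]; ring
  rw [h, sub_sub_cancel]
  rfl

theorem nsgdmNoise_succ {η : ℕ → ℝ} (x₁ : EuclideanSpace ℝ (Fin d)) (s : ℕ → Ξ) (k : ℕ) :
    nsgdmNoise agnosticMomentum η F g x₁ s (k + 1)
      = (1 - decayWeight k ^ 2) • nsgdmNoise agnosticMomentum η F g x₁ s k
        + decayWeight k ^ 2 • (g (nsgdmState agnosticMomentum η g x₁ s k).1 (s k)
          - gradient F (nsgdmState agnosticMomentum η g x₁ s k).1) := by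
  have h : decayWeight k ^ 2 = 1 - agnosticMomentum (k + 1) := by rw [agnosticMomentum_succ]; ring
  rw [h, sub_sub_cancel]
  rfl

end Recursion

section Trajectory

variable {d : ℕ} {Ω Ξ : Type*} [MeasurableSpace Ω] [MeasurableSpace Ξ]
  {P : Measure Ω} [IsProbabilityMeasure P] {D : Measure Ξ} [IsProbabilityMeasure D]
  {F : EuclideanSpace ℝ (Fin d) → ℝ} {Fstar L₀ L₁ σ : ℝ}
  {g : EuclideanSpace ℝ (Fin d) → Ξ → EuclideanSpace ℝ (Fin d)} {ξ : ℕ → Ω → Ξ}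

/-- Normalized steps keep each iterate within a deterministic distance of `x₁`, so its gradient is
bounded uniformly in `ω`. -/
theorem integrable_norm_gradient_nsgdmState (hL₀ : 0 ≤ L₀) (hL₁ : 0 ≤ L₁)
    (hF : IsL0L1Smooth L₀ L₁ F) (hg : Measurable (Function.uncurry g))
    (hξ : ∀ k, Measurable (ξ k)) (x₁ : EuclideanSpace ℝ (Fin d)) (k : ℕ) :
    Integrable (fun ω => ‖gradient F
      (nsgdmState agnosticMomentum agnosticStepsize g x₁ (fun i => ξ i ω) k).1‖) P := by
  have hm := (hF.continuous_gradient.measurable.comp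
    (measurable_nsgdmState (β := agnosticMomentum) (η := agnosticStepsize) hg x₁ k
      fun i _ => hξ i).fst).norm
  refine Integrable.of_bound hm.aestronglyMeasurable
    ((‖gradient F x₁‖ + L₀ * (4 / 7 * (decayWeight k)⁻¹))
        * Real.exp (L₁ * (4 / 7 * (decayWeight k)⁻¹)))
    (Filter.Eventually.of_forall fun ω => ?_)
  have h := hF.norm_gradient_mul_exp_le hL₀ hL₁
    (X := fun k => (nsgdmState agnosticMomentum agnosticStepsize g x₁ (fun i => ξ i ω) k).1)
    (M := fun k => (nsgdmState agnosticMomentum agnosticStepsize g x₁ (fun i => ξ i ω) k).2)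
    (nsgdmState_fst_succ (g := g) x₁ fun i => ξ i ω) k
  rw [norm_norm]
  refine le_trans (le_mul_of_one_le_right (norm_nonneg _) (Real.one_le_exp ?_)) h
  have := decayWeight_pos k
  positivity

theorem sum_integral_norm_gradient_le (hL₀ : 0 ≤ L₀) (hL₁ : 0 ≤ L₁) (hσ : 0 ≤ σ)
    (hlower : ∀ x, Fstar ≤ F x) (hF : IsL0L1Smooth L₀ L₁ F)
    (hg : IsBoundedVarianceOracle F D σ g) (hξ : ∀ k, Measurable (ξ k))
    (hlaw : ∀ k, P.map (ξ k) = D) (hindep : iIndepFun ξ P)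
    (x₁ : EuclideanSpace ℝ (Fin d)) (n : ℕ) :
    ∑ k ∈ Finset.range n, decayWeight k ^ 3 / 7 * ∫ ω, ‖gradient F
        (nsgdmState agnosticMomentum agnosticStepsize g x₁ (fun i => ξ i ω) k).1‖ ∂P
      ≤ 2 * (F x₁ - Fstar) + 4 / 7 * σ * (1 + Real.log n)
        + L₀ * (15 / 49 * Real.exp (L₁ / 7) + 4 / 49 * (1 + Real.log n))
        + 20 / 49 * L₁ ^ 2 * Real.exp (4 / 7 * L₁ ^ 2)
          * (‖gradient F x₁‖ + 4 / 7 * L₀) := by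
  have hFm := hF.continuous_gradient.measurable
  have hG (k : ℕ) := integrable_norm_gradient_nsgdmState (P := P) hL₀ hL₁ hF hg.measurable hξ x₁ k
  have hNi (k : ℕ) := (memLp_nsgdmNoise (η := agnosticStepsize)
    hFm hg hξ hlaw hindep x₁ k).integrable one_le_two
  have hNs := integrable_finsetSum (Finset.range n) fun k _ =>
    (hNi k).const_mul (decayWeight k ^ 3 / 7)
  have hpath (ω : Ω) := hF.sum_norm_gradient_le hL₀ hL₁ hlower
    (X := fun k => (nsgdmState agnosticMomentum agnosticStepsize g x₁ (fun i => ξ i ω) k).1)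
    (M := fun k => (nsgdmState agnosticMomentum agnosticStepsize g x₁ (fun i => ξ i ω) k).2)
    (N := nsgdmNoise agnosticMomentum agnosticStepsize F g x₁ (fun i => ξ i ω))
    (γ := fun k => g (nsgdmState agnosticMomentum agnosticStepsize g x₁ (fun i => ξ i ω) k).1 (ξ k ω))
    (nsgdmState_snd_succ (g := g) x₁ fun i => ξ i ω)
    (nsgdmNoise_succ (F := F) x₁ fun i => ξ i ω)
    (nsgdmState_fst_succ (g := g) x₁ fun i => ξ i ω) n
  set C := L₀ * (15 / 49 * Real.exp (L₁ / 7) + 4 / 49 * (1 + Real.log n)) with hC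
  set C' := 20 / 49 * L₁ ^ 2 * Real.exp (4 / 7 * L₁ ^ 2) * (‖gradient F x₁‖ + 4 / 7 * L₀) with hC'
  have hint := integral_mono (μ := P)
    (integrable_finsetSum _ fun k _ => (hG k).const_mul (decayWeight k ^ 3 / 7))
    ((((integrable_const (2 * (F x₁ - Fstar))).add (hNs.const_mul 4)).add
      (integrable_const C)).add (integrable_const C')) hpath
  rw [integral_add' (((integrable_const _).add (hNs.const_mul 4)).add (integrable_const C))
      (integrable_const C'),
    integral_add' ((integrable_const _).add (hNs.const_mul 4)) (integrable_const C),
    integral_add' (integrable_const _) (hNs.const_mul 4),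
    integral_finsetSum _ fun k _ => (hG k).const_mul _] at hint
  simp only [integral_const_mul, integral_const, probReal_univ, one_smul] at hint
  rw [integral_finsetSum _ fun k _ => (hNi k).const_mul _] at hint
  simp only [integral_const_mul] at hint
  have hsum : ∑ k ∈ Finset.range n, decayWeight k ^ 3 / 7
        * ∫ ω, ‖nsgdmNoise agnosticMomentum agnosticStepsize F g x₁ (fun i => ξ i ω) (k + 1)‖ ∂P
      ≤ σ / 7 * ∑ k ∈ Finset.range n, decayWeight k ^ 4 := by
    rw [Finset.mul_sum]
    refine Finset.sum_le_sum fun k _ => ?_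
    have h1 := integral_norm_nsgdmNoise_le (η := agnosticStepsize)
      hFm hσ hg hξ hlaw hindep x₁ k
    have hw := decayWeight_pos k
    calc _ ≤ decayWeight k ^ 3 / 7 * (σ * decayWeight k) := by gcongr
      _ = σ / 7 * decayWeight k ^ 4 := by ring
  have h2 := mul_le_mul_of_nonneg_left (sum_decayWeight_pow_four_le n)
    (by positivity : 0 ≤ σ / 7)
  linarith

end Trajectory

/-! ### Numerical constants and the conclusion. -/

theorem four_mul_one_add_log_le {T : ℕ} (hT : 2 ≤ T) :
    4 * (1 + Real.log T) ≤ 12 * Real.exp 1 * Real.log T := by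
  have h1 : Real.log 2 ≤ Real.log T := Real.log_le_log (by norm_num) (by exact_mod_cast hT)
  have h2 := Real.log_two_gt_d9
  have h3 := Real.exp_one_gt_d9
  nlinarith

/-- Constants of the general bound. -/
theorem agnostic_rate_le {L₀ L₁ Δ G m S ℓ : ℝ} (hL₀ : 0 ≤ L₀) (hL₁ : 0 ≤ L₁) (hΔ : 0 ≤ Δ)
    (hm : 0 ≤ m) (hℓ : 0 ≤ ℓ) (hG : G ≤ 8 * L₁ * Δ + m) :
    7 * (2 * Δ + S + L₀ * (15 / 49 * Real.exp (L₁ / 7) + 4 / 49 * (1 + ℓ))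
        + 20 / 49 * L₁ ^ 2 * Real.exp (4 / 7 * L₁ ^ 2) * (G + 4 / 7 * L₀))
      ≤ (14 + 96 * L₁ * Real.exp (L₁ ^ 2)) * Δ
        + (14 * Real.exp (L₁ / 7) + 9 * ℓ + 2 * Real.exp (L₁ ^ 2)) * L₀
        + 7 * S + 6 * Real.exp (L₁ ^ 2) * m := by
  have hE := Real.one_le_exp (by positivity : 0 ≤ L₁ / 7)
  have hY := Real.exp_pos (L₁ ^ 2)
  have hx := mul_exp_le_exp (sq_nonneg L₁)
  have h1 : 20 / 7 * (L₁ ^ 2 * Real.exp (4 / 7 * L₁ ^ 2)) * (G + 4 / 7 * L₀)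
      ≤ 20 / 7 * (7 / 6 * Real.exp (L₁ ^ 2)) * (8 * L₁ * Δ + m + 4 / 7 * L₀) := by
    refine (mul_le_mul_of_nonneg_left (by linarith) (by positivity)).trans
      (mul_le_mul_of_nonneg_right (by linarith) (by positivity))
  have h2 : L₀ * (15 / 7 * Real.exp (L₁ / 7) + 4 / 7 * (1 + ℓ))
      ≤ L₀ * (14 * Real.exp (L₁ / 7) + 9 * ℓ) :=
    mul_le_mul_of_nonneg_left (by linarith) hL₀
  have h3 : 0 ≤ Real.exp (L₁ ^ 2) * L₀ := by positivity
  have h4 : 0 ≤ Real.exp (L₁ ^ 2) * m := by positivity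
  have h5 : 0 ≤ Real.exp (L₁ ^ 2) * (L₁ * Δ) := by positivity
  linarith

/-- Constants of the bound for large `L₁`. -/
theorem agnostic_rate_le_of_large {L₀ L₁ Δ G S ℓ : ℝ} (hL₀ : 0 ≤ L₀) (hL₁ : 7 / 2 ≤ L₁)
    (hΔ : 0 ≤ Δ) (hℓ : 0 ≤ ℓ) (hG : G ≤ 8 * L₁ * Δ + 2 / 7 * L₀) :
    7 * (2 * Δ + S + L₀ * (15 / 49 * Real.exp (L₁ / 7) + 4 / 49 * (1 + ℓ))
        + 20 / 49 * L₁ ^ 2 * Real.exp (4 / 7 * L₁ ^ 2) * (G + 4 / 7 * L₀))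
      ≤ 126 * Real.exp (L₁ ^ 2) * Δ + 7 * S + (4 * Real.exp (L₁ ^ 2) + 9 * ℓ) * L₀ := by
  have hE := Real.one_le_exp (by positivity : 0 ≤ L₁ / 7)
  have hY : 1 ≤ Real.exp (L₁ ^ 2) := Real.one_le_exp (sq_nonneg L₁)
  have hx := mul_exp_le_exp (sq_nonneg L₁)
  have hx2 := sq_mul_exp_le_exp (x := L₁ ^ 2) (by nlinarith)
  have hEY : 3 * Real.exp (L₁ / 7) ≤ Real.exp (L₁ ^ 2) := by
    have e : Real.exp (L₁ ^ 2) = Real.exp (L₁ ^ 2 - L₁ / 7) * Real.exp (L₁ / 7) := by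
      rw [← Real.exp_add]
      ring_nf
    have h := Real.add_one_le_exp (L₁ ^ 2 - L₁ / 7)
    rw [e]
    gcongr
    nlinarith
  -- The constant `49/10` makes the early phase cost `20/7 * 8 * 49/10 = 112`, which with `14` gives
  -- `126`.
  have h1 : L₁ ^ 2 * Real.exp (4 / 7 * L₁ ^ 2) * L₁ ≤ 49 / 10 * Real.exp (L₁ ^ 2) := by
    refine le_trans ?_ hx2
    have h : L₁ ≤ L₁ ^ 2 := by nlinarith
    calc L₁ ^ 2 * Real.exp (4 / 7 * L₁ ^ 2) * L₁
        ≤ L₁ ^ 2 * Real.exp (4 / 7 * L₁ ^ 2) * L₁ ^ 2 := by gcongr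
      _ = _ := by ring
  have h2 : L₁ ^ 2 * Real.exp (4 / 7 * L₁ ^ 2) * G
      ≤ L₁ ^ 2 * Real.exp (4 / 7 * L₁ ^ 2) * (8 * L₁ * Δ + 2 / 7 * L₀) := by gcongr
  have h3 := mul_le_mul_of_nonneg_right h1 hΔ
  have h4 := mul_le_mul_of_nonneg_right hx hL₀
  have h5 := mul_le_mul_of_nonneg_right hY hΔ
  have h6 := mul_le_mul_of_nonneg_right hEY hL₀
  have h7 := mul_le_mul_of_nonneg_right hE hL₀
  have h8 := mul_nonneg hℓ hL₀
  linarith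

theorem mainTheorem2 {d : ℕ} {Ω Ξ : Type*} [MeasurableSpace Ω] [MeasurableSpace Ξ]
    (P : Measure Ω) [IsProbabilityMeasure P] (D : Measure Ξ) [IsProbabilityMeasure D]
    (F : EuclideanSpace ℝ (Fin d) → ℝ) (Fstar L₀ L₁ σ : ℝ)
    (hL₀ : 0 ≤ L₀) (hL₁ : 0 ≤ L₁) (hσ : 0 ≤ σ)
    (hlower : ∀ x, Fstar ≤ F x)
    (hsmooth : IsL0L1Smooth L₀ L₁ F)
    (g : EuclideanSpace ℝ (Fin d) → Ξ → EuclideanSpace ℝ (Fin d))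
    (hg : IsBoundedVarianceOracle F D σ g)
    (ξ : ℕ → Ω → Ξ) (hξ_meas : ∀ k, Measurable (ξ k))
    (hξ_law : ∀ k, P.map (ξ k) = D) (hξ_indep : iIndepFun ξ P)
    (x₁ : EuclideanSpace ℝ (Fin d))
    (x : ℕ → Ω → EuclideanSpace ℝ (Fin d))
    (hx : ∀ t ω, x t ω =
      nsgdmIterate agnosticMomentum agnosticStepsize g x₁ (fun k => ξ k ω) t)
    (Δ₁ : ℝ) (hΔ₁ : Δ₁ = F x₁ - Fstar)
    (T : ℕ) (hT : 1 ≤ T) :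
    (∀ t, 1 ≤ t → Integrable (fun ω => ‖gradient F (x t ω)‖) P) ∧
    (1 / (T : ℝ)) * ∑ t ∈ Finset.Icc 1 T, ∫ ω, ‖gradient F (x t ω)‖ ∂P
      ≤ ((14 + 96 * L₁ * Real.exp (L₁ ^ 2)) * Δ₁
          + (14 * Real.exp (L₁ / 7) + 9 * Real.log T + 2 * Real.exp (L₁ ^ 2)) * L₀
          + 12 * Real.exp 1 * Real.log T * σ
          + 6 * Real.exp (L₁ ^ 2) * minRatioSqrt L₀ L₁ Δ₁) / (T : ℝ) ^ (1 / 4 : ℝ) ∧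
    (7 / 2 ≤ L₁ →
      (1 / (T : ℝ)) * ∑ t ∈ Finset.Icc 1 T, ∫ ω, ‖gradient F (x t ω)‖ ∂P
        ≤ (126 * Real.exp (L₁ ^ 2) * Δ₁ + 12 * Real.exp 1 * Real.log T * σ
            + (4 * Real.exp (L₁ ^ 2) + 9 * Real.log T) * L₀) / (T : ℝ) ^ (1 / 4 : ℝ)) := by
  subst hΔ₁
  obtain ⟨n, rfl⟩ : ∃ n, T = n + 1 := ⟨T - 1, by omega⟩
  have hx' (t : ℕ) : x (t + 1) = fun ω =>
      (nsgdmState agnosticMomentum agnosticStepsize g x₁ (fun i => ξ i ω) t).1 := by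
    funext ω
    rw [hx]
    rfl
  have hG (k : ℕ) := integrable_norm_gradient_nsgdmState (P := P) hL₀ hL₁ hsmooth hg.measurable
    hξ_meas x₁ k
  set a : ℕ → ℝ := fun k => ∫ ω, ‖gradient F
    (nsgdmState agnosticMomentum agnosticStepsize g x₁ (fun i => ξ i ω) k).1‖ ∂P with ha
  have hsum : ∑ t ∈ Finset.Icc 1 (n + 1), ∫ ω, ‖gradient F (x t ω)‖ ∂P
      = ∑ k ∈ Finset.range (n + 1), a k := by
    rw [← Finset.Ico_add_one_right_eq_Icc, Finset.sum_Ico_eq_sum_range]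
    simp only [add_tsub_cancel_right, add_comm 1, hx', ha]
  have hΔ : 0 ≤ F x₁ - Fstar := sub_nonneg.2 (hlower x₁)
  have hm := minRatioSqrt_nonneg hL₀ hL₁ (F x₁ - Fstar)
  have hgrad := hsmooth.norm_gradient_le hL₀ hL₁ hlower x₁
  have hℓ : 0 ≤ Real.log ((n + 1 : ℕ) : ℝ) := Real.log_natCast_nonneg _
  rw [hsum]
  refine ⟨fun t ht => ?_, ?_⟩
  · obtain ⟨k, rfl⟩ : ∃ k, t = k + 1 := ⟨t - 1, by omega⟩
    rw [hx']
    exact hG k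
  -- For `T = 1` the logarithm vanishes and cannot absorb `1 + log T` in the noise term; but `x₁` is
  -- deterministic, so the gradient bound at `x₁` suffices.
  rcases Nat.eq_zero_or_pos n with rfl | hn
  · have ha0 : a 0 = ‖gradient F x₁‖ := by simp [ha, nsgdmState]
    have hY : 1 ≤ Real.exp (L₁ ^ 2) := Real.one_le_exp (sq_nonneg L₁)
    have hE := Real.exp_pos (L₁ / 7)
    have h1 := mul_le_mul_of_nonneg_right hY (mul_nonneg hL₁ hΔ)
    have h2 := mul_le_mul_of_nonneg_right hY hm
    have h3 := mul_le_mul_of_nonneg_right hY hL₀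
    simp only [zero_add, Nat.cast_one, Real.log_one, Real.one_rpow, div_one, one_mul,
      Finset.sum_range_one, mul_zero, zero_mul, add_zero, ha0]
    have h4 : 0 ≤ Real.exp (L₁ / 7) * L₀ := by positivity
    refine ⟨by nlinarith, fun hL => ?_⟩
    have h5 := minRatioSqrt_le_of_le hL₀ hL (F x₁ - Fstar)
    have h6 : 8 * L₁ ≤ 126 * Real.exp (L₁ ^ 2) := by
      nlinarith [Real.add_one_le_exp (L₁ ^ 2)]
    have h7 := mul_le_mul_of_nonneg_right h6 hΔ
    nlinarith
  · have hw := average_le_of_weighted_sum_le (fun k => integral_nonneg fun ω => norm_nonneg _)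
      (sum_integral_norm_gradient_le hL₀ hL₁ hσ hlower hsmooth hg hξ_meas hξ_law hξ_indep x₁
        (n + 1))
    have hlog := mul_le_mul_of_nonneg_right
      (four_mul_one_add_log_le (T := n + 1) (by omega)) hσ
    refine ⟨hw.trans ?_, fun hL => hw.trans ?_⟩
    · gcongr
      refine (agnostic_rate_le hL₀ hL₁ hΔ hm hℓ hgrad).trans ?_
      linarith
    · gcongr
      refine (agnostic_rate_le_of_large hL₀ hL hΔ hℓ (hgrad.trans (add_le_add le_rfl
        (minRatioSqrt_le_of_le hL₀ hL _)))).trans ?_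
      linarith
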